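/- Let $n\ge 2$, let $\mathcal P=\mathbb C[x_{ij}:1\le i\le n,\ 1\le j\le 2]$ be the algebra of polynomial functions on the space of $n\times 2$ complex matrices $X=(x_{ij})$, and let $\mathrm{GL}_n=\mathrm{GL}_n(\mathbb C)$ act on it by $(g.f)(X)=f(g^tX)$. Let $S_2$ act by permuting the two columns, $\tau.x_{ij}=x_{i\tau(j)}$. For $m\ge 0$ let $\mathcal Q_m\subset\mathcal P$ be the space of polynomials that are homogeneous of degree $m$ in each of the two columns, let $\mathcal Q=\bigoplus_{m\ge0}\mathcal Q_m$, and put $\mathcal Q^{S_2}=\{f\in\mathcal Q:\tau.f=f\ \forall\tau\in S_2\}$, $\mathcal Q^{\mathrm{sgn}}=\{f\in\mathcal Q:\tau.f=\mathrm{sgn}(\tau)f\ \forall\tau\in S_2\}$, $\mathcal Q_m^{S_2}=\mathcal Q^{S_2}\cap\mathcal Q_m$, $\mathcal Q_m^{\mathrm{sgn}}=\mathcal Q^{\mathrm{sgn}}\cap\mathcal Q_m$. Let $U_n\subset\mathrm{GL}_n$ be the group of upper triangular matrices with all diagonal entries $1$; $V^{U_n}$ denotes the space of $U_n$-invariants of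 a $\mathrm{GL}_n$-module $V$. A highest weight vector is a nonzero vector fixed by $U_n$ that is an eigenvector of every diagonal matrix in $\mathrm{GL}_n$. For a Young diagram $D$ with at most $n$ rows, $\rho_n^D$ denotes the irreducible polynomial representation of $\mathrm{GL}_n$ with highest weight $D$. Set $$\alpha=x_{11}x_{12},\qquad \gamma=\delta_{12}=x_{11}x_{22}-x_{12}x_{21}.$$ (i) The algebra $\mathcal Q^{U_n}$ is generated by $\alpha$ and $\gamma$, and the elements $\alpha^{m-a}\gamma^a$ with $m\ge 0$ and $0\le a\le m$ form a basis of $\mathcal Q^{U_n}$; for each fixed $m\ge 0$, those with $0\le a\le m$ form a basis of $(\mathcal Q_m)^{U_n}$. (ii) For each $m\ge1$, as $\mathrm{GL}_n$-modules, $$\mathcal Q_m^{S_2}\cong S^2(S^m(\mathbb C^n))\cong\bigoplus_{0\le a\le m,\ a\text{ even}}\rho_n^{(2m-a,a)},$$ and for each even $a$ with $0\le a\le m$, $\alpha^{m-a}\gamma^a$ is a highest weight vector, of weight $(2m-a,a)$, in the summand $\rho_n^{(2m-a,a)}$ of $\mathcal Q_m^{S_2}$; every highest weight vector of this summand is a scalar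 multiple of it. (iii) For each $m\ge1$, as $\mathrm{GL}_n$-modules, $$\mathcal Q_m^{\mathrm{sgn}}\cong \Lambda^2(S^m(\mathbb C^n))\cong\bigoplus_{1\le a\le m,\ a\text{ odd}}\rho_n^{(2m-a,a)},$$ and for each odd $a$ with $1\le a\le m$, $\alpha^{m-a}\gamma^a$ is a highest weight vector, of weight $(2m-a,a)$, in the summand $\rho_n^{(2m-a,a)}$ of $\mathcal Q_m^{\mathrm{sgn}}$; every highest weight vector of this summand is a scalar multiple of it. (iv) $(\mathcal Q^{S_2})^{U_n}=\mathbb C[\alpha,\gamma^2]$ and $(\mathcal Q^{\mathrm{sgn}})^{U_n}=\gamma\,(\mathcal Q^{S_2})^{U_n}=\gamma\,\mathbb C[\alpha,\gamma^2]$. -/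

import Mathlib

noncomputable section

namespace Plethysm

open MvPolynomial Matrix
open scoped TensorProduct MatrixGroups DirectSum

/-! ### Polynomial functions on the space of `n × k` complex matrices -/

/-- The algebra of polynomial functions on the space of `n × k` complex matrices; the variable
`X (i, j)` is the coordinate function of the entry in row `i` and column `j` (indices start
at `0`). -/
abbrev Poly (n k : ℕ) : Type := MvPolynomial (Fin n × Fin k) ℂ

/-- The generic `n × k` matrix, whose entries are the coordinate functions. -/
def genericMatrix (n k : ℕ) : Matrix (Fin n) (Fin k) (Poly n k) :=
  Matrix.of fun i j => X (i, j)

/-- The algebra endomorphism `f ↦ (X ↦ f(gᵗ X h))` of the algebra of polynomial functions. -/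
def polyActionHom (n k : ℕ) (g : Matrix (Fin n) (Fin n) ℂ) (h : Matrix (Fin k) (Fin k) ℂ) :
    Poly n k →ₐ[ℂ] Poly n k :=
  aeval fun p =>
    ((gᵀ.map C : Matrix (Fin n) (Fin n) (Poly n k)) * genericMatrix n k *
      (h.map C : Matrix (Fin k) (Fin k) (Poly n k))) p.1 p.2

theorem polyActionHom_X (n k : ℕ) (g : Matrix (Fin n) (Fin n) ℂ) (h : Matrix (Fin k) (Fin k) ℂ)
    (i : Fin n) (j : Fin k) :
    polyActionHom n k g h (X (i, j)) = ∑ t, ∑ s, C (g s i) * X (s, t) * C (h t j) := by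
  simp [polyActionHom, genericMatrix, Matrix.mul_apply, Finset.sum_mul]

/-- Pointwise description of the action: `(g, h).f` is the function `X ↦ f(gᵗ X h)`. -/
theorem eval_polyActionHom (n k : ℕ) (g : Matrix (Fin n) (Fin n) ℂ)
    (h : Matrix (Fin k) (Fin k) ℂ) (f : Poly n k) (M : Matrix (Fin n) (Fin k) ℂ) :
    eval (fun p => M p.1 p.2) (polyActionHom n k g h f) =
      eval (fun p => (gᵀ * M * h) p.1 p.2) f := by
  induction f using MvPolynomial.induction_on with
  | C a => simp [polyActionHom]
  | add p q hp hq => simp [hp, hq]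
  | mul_X p x hp =>
    obtain ⟨i, j⟩ := x
    rw [map_mul, map_mul, hp, map_mul, polyActionHom_X]
    simp [Matrix.mul_apply, Finset.sum_mul]

theorem poly_funext {n k : ℕ} {p q : Poly n k}
    (H : ∀ M : Matrix (Fin n) (Fin k) ℂ,
      eval (fun x => M x.1 x.2) p = eval (fun x => M x.1 x.2) q) : p = q :=
  MvPolynomial.funext fun x => by simpa using H (Matrix.of fun i j => x (i, j))

/-- The action of `GL_n × GL_k` on polynomial functions, `[(g, h).f](X) = f(gᵗ X h)`. -/
def polyAction (n k : ℕ) :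
    Representation ℂ (GL (Fin n) ℂ × GL (Fin k) ℂ) (Poly n k) where
  toFun x := (polyActionHom n k x.1 x.2).toLinearMap
  map_one' := by
    refine LinearMap.ext fun f => poly_funext fun M => ?_
    simp [eval_polyActionHom]
  map_mul' x y := by
    refine LinearMap.ext fun f => poly_funext fun M => ?_
    simp [eval_polyActionHom, Matrix.mul_assoc]

/-- The action of `GL_n` on polynomial functions, `[g.f](X) = f(gᵗ X)`. -/
def glRep (n k : ℕ) : Representation ℂ (GL (Fin n) ℂ) (Poly n k) :=
  (polyAction n k).comp (MonoidHom.inl (GL (Fin n) ℂ) (GL (Fin k) ℂ))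

/-- The action of the symmetric group on polynomial functions by permuting the columns,
`τ.x_{ij} = x_{i τ(j)}`. -/
def symRep (n k : ℕ) : Representation ℂ (Equiv.Perm (Fin k)) (Poly n k) where
  toFun τ := (rename (Prod.map id τ)).toLinearMap
  map_one' := by
    refine LinearMap.ext fun f => ?_
    simp
  map_mul' σ τ := by
    refine LinearMap.ext fun f => ?_
    simp only [AlgHom.toLinearMap_apply, Module.End.mul_apply, rename_rename]
    rfl

/-- The invertible diagonal matrix with the given diagonal entries, an element of the diagonal
torus. -/
def diagGL {n : ℕ} (t : Fin n → ℂˣ) : GL (Fin n) ℂ where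
  val := diagonal fun i => (t i : ℂ)
  inv := diagonal fun i => ((t i)⁻¹ : ℂˣ)
  val_inv := by simp [diagonal_mul_diagonal]
  inv_val := by simp [diagonal_mul_diagonal]

/-- Membership in the group `U_n` of upper triangular matrices with all diagonal entries `1`. -/
def IsUnipotentUpper {n : ℕ} (u : GL (Fin n) ℂ) : Prop :=
  (∀ i j : Fin n, j < i → (u : Matrix (Fin n) (Fin n) ℂ) i j = 0) ∧
    ∀ i : Fin n, (u : Matrix (Fin n) (Fin n) ℂ) i i = 1

/-! ### The graded algebra `𝒬`, its symmetric and alternating parts, and `U_n`-invariants -/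

/-- The multihomogeneous component `𝒫_d`: the weight space of weight `d` of the diagonal torus
of `GL_k`. -/
def multiComponent (n k : ℕ) (d : Fin k → ℕ) : Submodule ℂ (Poly n k) where
  carrier := {f | ∀ t : Fin k → ℂˣ,
    polyAction n k (1, diagGL t) f = (∏ j, (t j : ℂ) ^ d j) • f}
  add_mem' hf hg t := by rw [map_add, hf t, hg t, smul_add]
  zero_mem' t := by simp
  smul_mem' c f hf t := by rw [map_smul, hf t, smul_comm]

/-- `𝒬_m = 𝒫_{(m, …, m)}`. -/
def Qdeg (n k m : ℕ) : Submodule ℂ (Poly n k) := multiComponent n k fun _ => m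

/-- `𝒬`, the sum of all the `𝒬_m`. -/
def Q (n k : ℕ) : Submodule ℂ (Poly n k) := ⨆ m, Qdeg n k m

/-- The polynomials `f` with `τ.f = sgn(τ) f` for all permutations `τ`. -/
def sgnPart (n k : ℕ) : Submodule ℂ (Poly n k) where
  carrier := {f | ∀ τ : Equiv.Perm (Fin k),
    symRep n k τ f = ((Equiv.Perm.sign τ : ℤ) : ℂ) • f}
  add_mem' hf hg t := by rw [map_add, hf t, hg t, smul_add]
  zero_mem' t := by simp
  smul_mem' c f hf t := by rw [map_smul, hf t, smul_comm]

/-- The `U_n`-invariants of a `GL_n`-module. -/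
def unInvariants {n : ℕ} {V : Type*} [AddCommGroup V] [Module ℂ V]
    (ρ : Representation ℂ (GL (Fin n) ℂ) V) : Submodule ℂ V where
  carrier := {v | ∀ u : GL (Fin n) ℂ, IsUnipotentUpper u → ρ u v = v}
  add_mem' hf hg u hu := by rw [map_add, hf u hu, hg u hu]
  zero_mem' u _ := by simp
  smul_mem' c f hf u hu := by rw [map_smul, hf u hu]

/-- `𝒬^{S_k}`. -/
def Qsym (n k : ℕ) : Submodule ℂ (Poly n k) := Q n k ⊓ (symRep n k).invariants

/-- `𝒬^{sgn}`. -/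
def Qsgn (n k : ℕ) : Submodule ℂ (Poly n k) := Q n k ⊓ sgnPart n k

/-- A `GL_n`-highest weight vector: a nonzero vector fixed by `U_n` which is an eigenvector for
each element of the diagonal torus. -/
def IsHighestWeightVector {n : ℕ} {V : Type*} [AddCommGroup V] [Module ℂ V]
    (ρ : Representation ℂ (GL (Fin n) ℂ) V) (v : V) : Prop :=
  v ≠ 0 ∧ v ∈ unInvariants ρ ∧ ∀ t : Fin n → ℂˣ, ∃ c : ℂ, ρ (diagGL t) v = c • v

/-- The vector `v` has weight `D` (a Young diagram, identified with its sequence of row lengths):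
`diag(t_1, …, t_n).v = t_1^{D_1} ⋯ t_n^{D_n} v`. -/
def HasWeight {n : ℕ} {V : Type*} [AddCommGroup V] [Module ℂ V]
    (ρ : Representation ℂ (GL (Fin n) ℂ) V) (D : YoungDiagram) (v : V) : Prop :=
  ∀ t : Fin n → ℂˣ, ρ (diagGL t) v = (∏ i : Fin n, (t i : ℂ) ^ D.rowLen i) • v

theorem polyAction_eq_comp (n k : ℕ) (g : GL (Fin n) ℂ) (h : GL (Fin k) ℂ) (f : Poly n k) :
    polyAction n k (1, h) (glRep n k g f) = glRep n k g (polyAction n k (1, h) f) := by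
  simp only [glRep, MonoidHom.comp_apply, MonoidHom.inl_apply, ← Module.End.mul_apply,
    ← map_mul, Prod.mk_mul_mk, one_mul, mul_one]

theorem eval_symRep (n k : ℕ) (τ : Equiv.Perm (Fin k)) (f : Poly n k)
    (M : Matrix (Fin n) (Fin k) ℂ) :
    eval (fun x => M x.1 x.2) (symRep n k τ f) =
      eval (fun x => (M.submatrix id τ) x.1 x.2) f := by
  change eval _ (rename (Prod.map id τ) f) = _
  rw [eval_rename]
  rfl

theorem eval_glRep (n k : ℕ) (g : GL (Fin n) ℂ) (f : Poly n k) (M : Matrix (Fin n) (Fin k) ℂ) :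
    eval (fun x => M x.1 x.2) (glRep n k g f) =
      eval (fun x => ((g : Matrix (Fin n) (Fin n) ℂ)ᵀ * M) x.1 x.2) f := by
  have := eval_polyActionHom n k g 1 f M
  rw [Matrix.mul_one] at this
  exact this

theorem symRep_comm (n k : ℕ) (g : GL (Fin n) ℂ) (τ : Equiv.Perm (Fin k)) (f : Poly n k) :
    symRep n k τ (glRep n k g f) = glRep n k g (symRep n k τ f) := by
  refine poly_funext fun M => ?_
  rw [eval_symRep, eval_glRep, eval_glRep, eval_symRep]
  rfl

/-- `𝒬_m^{S_k} = 𝒬^{S_k} ∩ 𝒬_m`, as a `GL_n`-submodule. -/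
def QsymDeg (n k m : ℕ) : Subrepresentation (glRep n k) where
  toSubmodule := Qdeg n k m ⊓ (symRep n k).invariants
  apply_mem_toSubmodule g f hf :=
    ⟨fun t => by rw [polyAction_eq_comp, hf.1 t, map_smul],
      fun τ => by rw [symRep_comm, hf.2 τ]⟩

/-- `𝒬_m^{sgn} = 𝒬^{sgn} ∩ 𝒬_m`, as a `GL_n`-submodule. -/
def QsgnDeg (n k m : ℕ) : Subrepresentation (glRep n k) where
  toSubmodule := Qdeg n k m ⊓ sgnPart n k
  apply_mem_toSubmodule g f hf :=
    ⟨fun t => by rw [polyAction_eq_comp, hf.1 t, map_smul],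
      fun τ => by rw [symRep_comm, hf.2 τ, map_smul]⟩

/-! ### Symmetric and exterior powers of representations -/

section Powers

variable {V W : Type} [AddCommGroup V] [Module ℂ V] [AddCommGroup W] [Module ℂ W]

/-- The linear map between symmetric powers induced by a linear map. -/
def symPowMap (m : ℕ) (f : V →ₗ[ℂ] W) : SymmetricPower ℂ (Fin m) V →ₗ[ℂ]
    SymmetricPower ℂ (Fin m) W where
  __ := AddCon.lift (addConGen (SymmetricPower.Rel ℂ (Fin m) V))
    (SymmetricPower.mk ℂ (Fin m) W ∘ₗ PiTensorProduct.map fun _ => f).toAddMonoidHom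
    (AddCon.addConGen_le.mpr fun x y h => by
      cases h with
      | perm e v =>
        change SymmetricPower.mk ℂ (Fin m) W _ = SymmetricPower.mk ℂ (Fin m) W _
        rw [PiTensorProduct.map_tprod, PiTensorProduct.map_tprod]
        exact (SymmetricPower.tprod_equiv (R := ℂ) e fun i => f (v i)).symm)
  map_smul' c x := by
    induction x using AddCon.induction_on with
    | H x =>
      exact ((SymmetricPower.mk ℂ (Fin m) W ∘ₗ PiTensorProduct.map fun _ => f).map_smul c x)

theorem symPowMap_tprod (m : ℕ) (f : V →ₗ[ℂ] W) (v : Fin m → V) :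
    symPowMap m f (SymmetricPower.tprod ℂ v) = SymmetricPower.tprod ℂ fun i => f (v i) := by
  change SymmetricPower.mk ℂ (Fin m) W (PiTensorProduct.map (fun _ => f)
    (PiTensorProduct.tprod ℂ v)) = _
  rw [PiTensorProduct.map_tprod]
  rfl

theorem symPow_ext (m : ℕ) {f g : SymmetricPower ℂ (Fin m) V →ₗ[ℂ] W}
    (h : ∀ v : Fin m → V, f (SymmetricPower.tprod ℂ v) = g (SymmetricPower.tprod ℂ v)) :
    f = g :=
  LinearMap.ext_on_range (SymmetricPower.span_tprod_eq_top ℂ (Fin m) V) h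

/-- The `m`-th symmetric power `S^m(V)` of a representation:
`g.(v_1 ⋯ v_m) = (g.v_1) ⋯ (g.v_m)`. -/
def symPow {G : Type} [Monoid G] (m : ℕ) (ρ : Representation ℂ G V) :
    Representation ℂ G (SymmetricPower ℂ (Fin m) V) where
  toFun g := symPowMap m (ρ g)
  map_one' := symPow_ext m fun v => by simp [symPowMap_tprod]
  map_mul' g h := symPow_ext m fun v => by simp [symPowMap_tprod]

/-- The `m`-th exterior power `Λ^m(V)` of a representation:
`g.(v_1 ∧ ⋯ ∧ v_m) = (g.v_1) ∧ ⋯ ∧ (g.v_m)`. -/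
def extPow {G : Type} [Monoid G] (m : ℕ) (ρ : Representation ℂ G V) :
    Representation ℂ G (⋀[ℂ]^m V) where
  toFun g := exteriorPower.map m (ρ g)
  map_one' := by rw [map_one]; exact exteriorPower.map_id
  map_mul' g h := by
    rw [map_mul]
    ext v
    simp
    rfl

end Powers

/-- The standard representation of `GL_n` on `ℂ^n`. -/
def stdRep (n : ℕ) : Representation ℂ (GL (Fin n) ℂ) (Fin n → ℂ) where
  toFun g := Matrix.mulVecLin (g : Matrix (Fin n) (Fin n) ℂ)
  map_one' := by simp; rfl
  map_mul' g h := by simp [Matrix.mulVecLin_mul]; rfl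

/-! ### The irreducible polynomial representations of `GL_n` -/

/-- The leading principal minor of size `i + 1` of the generic `n × n` matrix. -/
def leadingMinor (n : ℕ) (i : Fin n) : Poly n n :=
  ((genericMatrix n n).submatrix
    (Fin.castLE i.isLt : Fin (i + 1) → Fin n) (Fin.castLE i.isLt : Fin (i + 1) → Fin n)).det

/-- For a Young diagram `D` with row lengths `D_1 ≥ ⋯ ≥ D_n ≥ 0`, the product of the powers
`Δ_i ^ (D_i - D_{i+1})` of the leading principal minors, a highest weight vector of weight `D`. -/
def minorProduct (n : ℕ) (D : YoungDiagram) : Poly n n :=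
  ∏ i : Fin n, leadingMinor n i ^ (D.rowLen i - D.rowLen (i + 1))

/-- The irreducible polynomial representation `ρ_n^D` of `GL_n` with highest weight `D`, where `D`
is a Young diagram with at most `n` rows, in its standard realization on polynomial functions: the
`GL_n`-submodule generated by the product of minors of weight `D`. -/
def irrep (n : ℕ) (D : YoungDiagram) : Subrepresentation (glRep n n) where
  toSubmodule := Submodule.span ℂ (Set.range fun g : GL (Fin n) ℂ => glRep n n g (minorProduct n D))
  apply_mem_toSubmodule g v hv := by
    induction hv using Submodule.span_induction with
    | mem x hx =>
      obtain ⟨h, rfl⟩ := hx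
      exact Submodule.subset_span ⟨g * h, by simp⟩
    | zero => simp
    | add x y _ _ hx hy => rw [map_add]; exact Submodule.add_mem _ hx hy
    | smul c x _ hx => rw [map_smul]; exact Submodule.smul_mem _ c hx

/-- The Young diagram with (at most) two rows, of lengths `p ≥ q`. -/
def twoRow (p q : ℕ) (h : q ≤ p) : YoungDiagram :=
  YoungDiagram.ofRowLens [p, q] (by simpa [List.sortedGE_iff_pairwise] using h)

theorem rowLen_twoRow (p q : ℕ) (h : q ≤ p) (i : ℕ) :
    (twoRow p q h).rowLen i = if i = 0 then p else if i = 1 then q else 0 := by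
  have key : ∀ j, j < (twoRow p q h).rowLen i ↔
      j < if i = 0 then p else if i = 1 then q else 0 := by
    intro j
    rw [← YoungDiagram.mem_iff_lt_rowLen, twoRow, YoungDiagram.mem_ofRowLens]
    rcases i with _ | _ | i <;> simp
  exact le_antisymm (le_of_forall_lt fun j hj => (key j).1 hj)
    (le_of_forall_lt fun j hj => (key j).2 hj)

/-- The diagram `(2m - a, a)`, for `a ≤ m`. -/
def diagram (m a : ℕ) (h : a ≤ m) : YoungDiagram := twoRow (2 * m - a) a (by omega)

/-! ### The two generators in the case `k = 2` -/

/-- `α = x_{11} x_{12}`. -/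
def alpha (n : ℕ) (hn : 2 ≤ n) : Poly n 2 :=
  X (⟨0, by omega⟩, 0) * X (⟨0, by omega⟩, 1)

/-- `γ = δ_{12}`, the determinant of the first two rows. -/
def gamma (n : ℕ) (hn : 2 ≤ n) : Poly n 2 :=
  !![X (⟨0, by omega⟩, 0), X (⟨0, by omega⟩, 1);
     X (⟨1, by omega⟩, 0), X (⟨1, by omega⟩, 1)].det

end Plethysm

end

open Plethysm

noncomputable section

namespace Plethysm

open MvPolynomial Matrix
open scoped TensorProduct MatrixGroups DirectSum

/-! ### The action on coordinate functions -/

/-! On a generic `n × 2` matrix, row operations by the transpose of an element of `U_n` clear all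
entries except `x, y` in the first row and `z` at the end of the second, where `x z` is the value of
`γ`. A `U_n`-invariant of degree `m` in each column is thus a combination of the functions `x^m
y^(m-a) z^a = (xy)^(m-a) (xz)^a`. Since the two column degrees agree, no denominator survives, and
the invariants in `𝒬_m` are spanned by the `α^(m-a) γ^a` (`exists_eq_sum_hwv`). For fixed `m` their
weights are distinct, so each weight occurs once among the invariants (`eq_smul_hwv`).

The decomposition is then elementary highest weight theory. For the Fischer inner product the
adjoint of `g` is its conjugate transpose (`fischer_glRep`), so finite-dimensional stable subspaces
have stable complements (`exists_complement`). `U_n` acts unipotently on the finite-dimensional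
`𝒬_m`, so a nonzero stable subspace contains a nonzero invariant (`exists_unInvariant`). Hence each
`α^(m-a) γ^a` generates an irreducible module (`eq_bot_or_eq_cyclic`), and a stable subspace of
`𝒬_m` is the sum of those modules whose generators it contains (`iSup_cyclic_hwv_eq`). The sum is
direct because a composite of two polarization operators, which commutes with `GL_n`, acts on these
modules by different scalars (`iSupIndep_cyclic_hwv`). Powers of polarization operators also carry
the generators to the minor products that define `ρ_n^D`, and back (`nonempty_equiv_irrep`).

The column swap fixes `α` and negates `γ`, so the parity of `a` decides between the symmetric and
the alternating part. These parts are the symmetric and exterior squares because a monomial of `𝒬_m`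
is a pair of monomials of degree `m`, one in each column (`nonempty_equiv_square`). -/

theorem glRep_apply (n k : ℕ) (g : GL (Fin n) ℂ) (f : Poly n k) :
    glRep n k g f = polyActionHom n k g 1 f := rfl

theorem glRep_X (n k : ℕ) (g : GL (Fin n) ℂ) (i : Fin n) (j : Fin k) :
    glRep n k g (X (i, j)) = ∑ s, C ((g : Matrix (Fin n) (Fin n) ℂ) s i) * X (s, j) := by
  rw [glRep_apply, polyActionHom_X, Finset.sum_comm]
  refine Finset.sum_congr rfl fun s _ => ?_
  rw [Finset.sum_eq_single j]
  · simp
  · intro t _ ht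
    simp [Matrix.one_apply_ne ht]
  · simp

theorem glRep_mul (n k : ℕ) (g : GL (Fin n) ℂ) (f h : Poly n k) :
    glRep n k g (f * h) = glRep n k g f * glRep n k g h := by
  simp only [glRep_apply, map_mul]

theorem glRep_pow (n k : ℕ) (g : GL (Fin n) ℂ) (f : Poly n k) (a : ℕ) :
    glRep n k g (f ^ a) = glRep n k g f ^ a := by
  simp only [glRep_apply, map_pow]

theorem glRep_C (n k : ℕ) (g : GL (Fin n) ℂ) (c : ℂ) :
    glRep n k g (C c) = C c := by
  simp only [glRep_apply, algHom_C, algebraMap_eq]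

/-! ### Spans of orbits -/

section Cyclic

variable {G V W : Type*} [Group G] [AddCommGroup V] [Module ℂ V] [AddCommGroup W] [Module ℂ W]

/-- The subrepresentation generated by a vector. -/
def cyclic (ρ : Representation ℂ G V) (v : V) : Subrepresentation ρ where
  toSubmodule := Submodule.span ℂ (Set.range fun g : G => ρ g v)
  apply_mem_toSubmodule g w hw := by
    induction hw using Submodule.span_induction with
    | mem x hx =>
      obtain ⟨h, rfl⟩ := hx
      exact Submodule.subset_span ⟨g * h, by simp⟩
    | zero => simp
    | add x y _ _ hx hy => rw [map_add]; exact Submodule.add_mem _ hx hy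
    | smul c x _ hx => rw [map_smul]; exact Submodule.smul_mem _ c hx

theorem mem_cyclic (ρ : Representation ℂ G V) (v : V) : v ∈ cyclic ρ v :=
  Submodule.subset_span ⟨1, by simp⟩

theorem cyclic_le {ρ : Representation ℂ G V} {v : V} {S : Subrepresentation ρ} (h : v ∈ S) :
    (cyclic ρ v).toSubmodule ≤ S.toSubmodule := by
  refine Submodule.span_le.2 ?_
  rintro _ ⟨g, rfl⟩
  exact S.apply_mem_toSubmodule g h

theorem map_mem_cyclic {ρ : Representation ℂ G V} {σ : Representation ℂ G W} {v : V} {w : W}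
    (T : V →ₗ[ℂ] W) (hT : ∀ g x, T (ρ g x) = σ g (T x)) (hv : T v = w) {x : V}
    (hx : x ∈ (cyclic ρ v).toSubmodule) : T x ∈ (cyclic σ w).toSubmodule := by
  induction hx using Submodule.span_induction with
  | mem x hx =>
    obtain ⟨g, rfl⟩ := hx
    simp only [hT, hv]
    exact Submodule.subset_span ⟨g, rfl⟩
  | zero => simp
  | add x y _ _ hx hy => rw [map_add]; exact Submodule.add_mem _ hx hy
  | smul c x _ hx => rw [map_smul]; exact Submodule.smul_mem _ c hx

theorem apply_eq_of_mem_cyclic {ρ : Representation ℂ G V} {v : V} {c : ℂ}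
    (T : V →ₗ[ℂ] V) (hT : ∀ g x, T (ρ g x) = ρ g (T x)) (hv : T v = c • v) {x : V}
    (hx : x ∈ (cyclic ρ v).toSubmodule) : T x = c • x := by
  induction hx using Submodule.span_induction with
  | mem x hx =>
    obtain ⟨g, rfl⟩ := hx
    simp only [hT, hv, map_smul]
  | zero => simp
  | add x y _ _ hx hy => rw [map_add, hx, hy, smul_add]
  | smul c x _ hx => rw [map_smul, hx, smul_comm]

/-- Two cyclic representations are isomorphic if there are equivariant maps which send the
generators to each other. -/
def cyclicEquiv {ρ : Representation ℂ G V} {σ : Representation ℂ G W} {v : V} {w : W}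
    (T : V →ₗ[ℂ] W) (hT : ∀ g x, T (ρ g x) = σ g (T x)) (hv : T v = w)
    (S : W →ₗ[ℂ] V) (hS : ∀ g x, S (σ g x) = ρ g (S x)) (hw : S w = v) :
    (cyclic ρ v).toRepresentation.Equiv (cyclic σ w).toRepresentation :=
  Representation.Equiv.mk
    (LinearEquiv.ofLinearMap
      (T.restrict fun _ hx => map_mem_cyclic T hT hv hx)
      (S.restrict fun _ hx => map_mem_cyclic S hS hw hx)
      (by
        ext ⟨x, hx⟩
        -- The composite is equivariant and fixes the generator, hence it is the identity on the
        -- cyclic module.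
        have := apply_eq_of_mem_cyclic (c := 1) (T ∘ₗ S) (fun g x => by simp [hS, hT])
          (by simp [hv, hw]) hx
        simpa using this)
      (by
        ext ⟨x, hx⟩
        have := apply_eq_of_mem_cyclic (c := 1) (S ∘ₗ T) (fun g x => by simp [hS, hT])
          (by simp [hv, hw]) hx
        simpa using this))
    (fun g => by
      ext ⟨x, hx⟩
      exact hT g x)

end Cyclic

/-- If a sum of eigenvectors with distinct eigenvalues lies in a stable subspace, so does each
of them. -/
theorem mem_of_sum_eigenvectors {M ι : Type*} [AddCommGroup M] [Module ℂ M] (T : M →ₗ[ℂ] M)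
    (V : Submodule ℂ M) (hV : ∀ x ∈ V, T x ∈ V) (μ : ι → ℂ) (s : Finset ι) :
    Set.InjOn μ s → ∀ v : ι → M, (∀ i ∈ s, T (v i) = μ i • v i) →
      ∑ i ∈ s, v i ∈ V → ∀ i ∈ s, v i ∈ V := by
  classical
  induction s using Finset.induction_on with
  | empty => simp
  | insert a s ha ih =>
    intro hμ v hv hsum
    have hs : ∀ i ∈ s, v i ∈ V := by
      intro i hi
      have hne : μ i - μ a ≠ 0 := sub_ne_zero.2 fun h =>
        ha (hμ (Finset.mem_insert_of_mem hi) (Finset.mem_insert_self a s) h ▸ hi)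
      -- Applying `T - μ a` to the sum removes the term at `a` and scales each other term by the
      -- nonzero factor `μ i - μ a`.
      have key := ih (hμ.mono (by simp)) (fun i => (μ i - μ a) • v i)
        (fun i hi => by
          rw [map_smul, hv i (Finset.mem_insert_of_mem hi), smul_comm]) ?_ i hi
      · exact (V.smul_mem_iff hne).1 key
      · have h2 := V.sub_mem (hV _ hsum) (V.smul_mem (μ a) hsum)
        rw [map_sum, Finset.smul_sum, ← Finset.sum_sub_distrib, Finset.sum_insert ha,
          hv a (Finset.mem_insert_self a s), sub_self, zero_add] at h2
        convert h2 using 1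
        refine Finset.sum_congr rfl fun i hi => ?_
        rw [hv i (Finset.mem_insert_of_mem hi), sub_smul]
    intro i hi
    rcases Finset.mem_insert.1 hi with rfl | hi
    · rw [Finset.sum_insert ha] at hsum
      exact (V.add_mem_iff_left (V.sum_mem hs)).1 hsum
    · exact hs i hi

/-! ### The Fischer inner product -/

section Fischer

variable {σ : Type*} [Fintype σ]

/-- The factorial of a multi-index. -/
def multiFactorial (E : σ →₀ ℕ) : ℕ := ∏ p, (E p).factorial

/-- The Fischer inner product `∑ E! conj(f_E) h_E` of two polynomials. -/
def fischer (f h : MvPolynomial σ ℂ) : ℂ :=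
  ∑ E ∈ f.support, multiFactorial E * (starRingEnd ℂ (coeff E f) * coeff E h)

/-- A term vanishes as soon as one of the two coefficients does. Summing over a set that contains
either support gives access to both arguments on equal terms. -/
theorem fischer_eq_sum {f h : MvPolynomial σ ℂ} (s : Finset (σ →₀ ℕ))
    (hs : f.support ⊆ s ∨ h.support ⊆ s) :
    fischer f h = ∑ E ∈ s, multiFactorial E * (starRingEnd ℂ (coeff E f) * coeff E h) := by
  classical
  have hu : fischer f h = ∑ E ∈ f.support ∪ s,
      multiFactorial E * (starRingEnd ℂ (coeff E f) * coeff E h) := by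
    refine Finset.sum_subset Finset.subset_union_left fun E _ hE => ?_
    rw [notMem_support_iff.1 hE]
    simp
  rw [hu]
  refine (Finset.sum_subset Finset.subset_union_right fun E _ hE => ?_).symm
  rcases hs with hs | hs
  · rw [notMem_support_iff.1 fun h => hE (hs h)]
    simp
  · rw [notMem_support_iff.1 fun h => hE (hs h)]
    simp

theorem fischer_add_left (f g h : MvPolynomial σ ℂ) :
    fischer (f + g) h = fischer f h + fischer g h := by
  simp only [fischer_eq_sum h.support (Or.inr subset_rfl), coeff_add, map_add,
    ← Finset.sum_add_distrib]
  exact Finset.sum_congr rfl fun E _ => by ring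

theorem fischer_smul_left (c : ℂ) (f h : MvPolynomial σ ℂ) :
    fischer (c • f) h = starRingEnd ℂ c * fischer f h := by
  simp only [fischer_eq_sum h.support (Or.inr subset_rfl), coeff_smul, smul_eq_mul, map_mul,
    Finset.mul_sum]
  exact Finset.sum_congr rfl fun E _ => by ring

theorem conj_fischer (f h : MvPolynomial σ ℂ) : starRingEnd ℂ (fischer h f) = fischer f h := by
  rw [fischer_eq_sum h.support (Or.inr subset_rfl), fischer, map_sum]
  refine Finset.sum_congr rfl fun E _ => ?_
  simp only [map_mul, map_natCast, Complex.conj_conj]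
  ring

theorem fischer_self (f : MvPolynomial σ ℂ) :
    fischer f f = ((∑ E ∈ f.support, multiFactorial E * Complex.normSq (coeff E f) : ℝ) : ℂ) := by
  rw [fischer, Complex.ofReal_sum]
  refine Finset.sum_congr rfl fun E _ => ?_
  rw [Complex.ofReal_mul, Complex.ofReal_natCast, Complex.normSq_eq_conj_mul_self]

theorem multiFactorial_pos (E : σ →₀ ℕ) : 0 < multiFactorial E :=
  Finset.prod_pos fun _ _ => Nat.factorial_pos _

theorem eq_zero_of_fischer_self {f : MvPolynomial σ ℂ} (h : fischer f f = 0) : f = 0 := by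
  rw [fischer_self, Complex.ofReal_eq_zero, Finset.sum_eq_zero_iff_of_nonneg
    fun E _ => mul_nonneg (Nat.cast_nonneg _) (Complex.normSq_nonneg _)] at h
  ext E
  by_contra hE
  have := h E (mem_support_iff.2 hE)
  rw [mul_eq_zero, Nat.cast_eq_zero, Complex.normSq_eq_zero] at this
  exact this.elim (multiFactorial_pos E).ne' hE

variable (σ) in
/-- The Fischer inner product as a positive definite sesquilinear form. -/
abbrev fischerCore : InnerProductSpace.Core ℂ (MvPolynomial σ ℂ) where
  inner := fischer
  conj_inner_symm := conj_fischer
  re_inner_nonneg f := by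
    rw [fischer_self]
    exact Finset.sum_nonneg fun E _ => mul_nonneg (Nat.cast_nonneg _) (Complex.normSq_nonneg _)
  add_left := fischer_add_left
  smul_left f h c := fischer_smul_left c f h
  definite _ := eq_zero_of_fischer_self

/-- Each finite-dimensional space of polynomials is complemented by its orthogonal space. -/
theorem exists_fischer_orthogonal (V : Submodule ℂ (MvPolynomial σ ℂ)) [FiniteDimensional ℂ V]
    (f : MvPolynomial σ ℂ) : ∃ p ∈ V, ∀ v ∈ V, fischer v (f - p) = 0 := by
  -- The polynomial ring is not complete, but the finite-dimensional `V` is, and that suffices for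
  -- an orthogonal projection onto `V`.
  let _ : NormedAddCommGroup (MvPolynomial σ ℂ) := (fischerCore σ).toNormedAddCommGroup
  let _ : InnerProductSpace ℂ (MvPolynomial σ ℂ) := InnerProductSpace.ofCore (fischerCore σ).toCore
  obtain ⟨p, hp, q, hq, rfl⟩ := V.exists_add_mem_mem_orthogonal f
  exact ⟨p, hp, fun v hv => by rw [add_sub_cancel_left]; exact hq v hv⟩

theorem fischer_C_left (c : ℂ) (h : MvPolynomial σ ℂ) :
    fischer (C c) h = starRingEnd ℂ c * constantCoeff h := by
  classical
  rw [fischer_eq_sum {0} (Or.inl (by rw [C_apply]; exact support_monomial_subset)),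
    Finset.sum_singleton]
  simp [multiFactorial, constantCoeff_eq]

theorem fischer_monomial_left (E : σ →₀ ℕ) (c : ℂ) (h : MvPolynomial σ ℂ) :
    fischer (monomial E c) h = multiFactorial E * (starRingEnd ℂ c * coeff E h) := by
  classical
  rw [fischer_eq_sum {E} (Or.inl support_monomial_subset), Finset.sum_singleton,
    coeff_monomial, if_pos rfl]

theorem multiFactorial_add_single (E : σ →₀ ℕ) (p : σ) :
    multiFactorial (E + Finsupp.single p 1) = (E p + 1) * multiFactorial E := by
  classical
  unfold multiFactorial
  rw [← Finset.mul_prod_erase _ _ (Finset.mem_univ p),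
    ← Finset.mul_prod_erase Finset.univ (fun p => (E p).factorial) (Finset.mem_univ p)]
  rw [Finsupp.add_apply, Finsupp.single_eq_same, Nat.factorial_succ, mul_assoc]
  congr 2
  refine Finset.prod_congr rfl fun q hq => ?_
  rw [Finsupp.add_apply, Finsupp.single_eq_of_ne (Finset.ne_of_mem_erase hq), add_zero]

/-- The factorial weights are chosen for this: multiplication by a variable becomes adjoint to the
derivative in that variable. -/
theorem fischer_mul_X_left (p : σ) (f h : MvPolynomial σ ℂ) :
    fischer (f * X p) h = fischer f (pderiv p h) := by
  induction f using MvPolynomial.induction_on' with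
  | monomial E c =>
    rw [X, monomial_mul, mul_one, fischer_monomial_left, fischer_monomial_left, coeff_pderiv,
      multiFactorial_add_single]
    push_cast
    ring
  | add f g hf hg => rw [add_mul, fischer_add_left, hf, hg, fischer_add_left]

theorem fischer_sum_right {ι : Type*} (s : Finset ι) (f : MvPolynomial σ ℂ)
    (h : ι → MvPolynomial σ ℂ) : fischer f (∑ i ∈ s, h i) = ∑ i ∈ s, fischer f (h i) := by
  simp only [fischer, coeff_sum, Finset.mul_sum]
  exact Finset.sum_comm

theorem fischer_sum_left {ι : Type*} (s : Finset ι) (f : MvPolynomial σ ℂ)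
    (h : ι → MvPolynomial σ ℂ) : fischer (∑ i ∈ s, h i) f = ∑ i ∈ s, fischer (h i) f := by
  simp only [← conj_fischer _ f, fischer_sum_right, map_sum]

theorem fischer_smul_right (c : ℂ) (f h : MvPolynomial σ ℂ) :
    fischer f (c • h) = c * fischer f h := by
  rw [← conj_fischer, fischer_smul_left, map_mul, Complex.conj_conj, conj_fischer]

end Fischer

/-- This is the chain rule for the linear substitution `X ↦ gᵗ X`; both sides obey the Leibniz rule,
so variables are enough. -/
theorem pderiv_glRep (n k : ℕ) (g : GL (Fin n) ℂ) (i : Fin n) (j : Fin k) (f : Poly n k) :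
    pderiv (i, j) (glRep n k g f) =
      ∑ s, (g : Matrix (Fin n) (Fin n) ℂ) i s • glRep n k g (pderiv (s, j) f) := by
  induction f using MvPolynomial.induction_on with
  | C a => simp [glRep_C]
  | add p q hp hq => simp only [map_add, hp, hq, smul_add, Finset.sum_add_distrib]
  | mul_X p x hp =>
    obtain ⟨a, b⟩ := x
    have h1 : pderiv (i, j) (glRep n k g (X (a, b))) =
        ∑ s, (g : Matrix (Fin n) (Fin n) ℂ) i s • glRep n k g (pderiv (s, j) (X (a, b))) := by
      classical
      rw [glRep_X]
      by_cases hb : b = j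
      · subst hb
        simp [pderiv_X, Pi.single_apply, glRep_apply, apply_ite, Derivation.leibniz, smul_eq_C_mul]
      · simp [pderiv_X, glRep_apply, hb, Derivation.leibniz]
    simp only [glRep_mul, Derivation.leibniz, map_add, hp, h1, smul_eq_mul, Finset.mul_sum,
      smul_add, Finset.sum_add_distrib]
    congr 1 <;> exact Finset.sum_congr rfl fun s _ => by rw [mul_smul_comm]

theorem constantCoeff_glRep (n k : ℕ) (g : GL (Fin n) ℂ) (f : Poly n k) :
    constantCoeff (glRep n k g f) = constantCoeff f := by
  induction f using MvPolynomial.induction_on with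
  | C a => rw [glRep_C]
  | add p q hp hq => simp only [map_add, hp, hq]
  | mul_X p x hp =>
    obtain ⟨i, j⟩ := x
    rw [glRep_mul, glRep_X]
    simp

/-- The adjoint of an invertible matrix. -/
def conjGL {n : ℕ} (g : GL (Fin n) ℂ) : GL (Fin n) ℂ where
  val := (g : Matrix (Fin n) (Fin n) ℂ)ᴴ
  inv := ((g⁻¹ : GL (Fin n) ℂ) : Matrix (Fin n) (Fin n) ℂ)ᴴ
  val_inv := by
    rw [← conjTranspose_mul, ← Units.val_mul, inv_mul_cancel, Units.val_one, conjTranspose_one]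
  inv_val := by
    rw [← conjTranspose_mul, ← Units.val_mul, mul_inv_cancel, Units.val_one, conjTranspose_one]

/-- With respect to the Fischer inner product, the adjoint of the action of `g` is the action of
the conjugate transpose of `g`. -/
theorem fischer_glRep (n k : ℕ) (g : GL (Fin n) ℂ) (f h : Poly n k) :
    fischer (glRep n k g f) h = fischer f (glRep n k (conjGL g) h) := by
  -- The second argument has to vary: moving a variable off `f` replaces `h` by its derivatives.
  induction f using MvPolynomial.induction_on generalizing h with
  | C a => rw [glRep_C, fischer_C_left, fischer_C_left, constantCoeff_glRep]
  | add p q hp hq => rw [map_add, fischer_add_left, fischer_add_left, hp, hq]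
  | mul_X p x hp =>
    obtain ⟨i, j⟩ := x
    rw [glRep_mul, glRep_X, fischer_mul_X_left, pderiv_glRep, fischer_sum_right, Finset.mul_sum,
      fischer_sum_left]
    refine Finset.sum_congr rfl fun s _ => ?_
    rw [mul_left_comm, ← smul_eq_C_mul, fischer_smul_left, fischer_mul_X_left, hp,
      fischer_smul_right]
    rfl

/-- Complete reducibility. -/
theorem exists_complement {n k : ℕ} (V : Subrepresentation (glRep n k))
    [FiniteDimensional ℂ V.toSubmodule] :
    ∃ V' : Subrepresentation (glRep n k), V.toSubmodule ⊓ V'.toSubmodule = ⊥ ∧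
      V.toSubmodule ⊔ V'.toSubmodule = ⊤ := by
  -- The complement is the Fischer-orthogonal space. It is stable because the adjoint of `g` is
  -- again the action of an invertible matrix, which preserves `V`.
  refine ⟨⟨{ carrier := {f | ∀ v ∈ V.toSubmodule, fischer v f = 0}
             add_mem' := fun hf hg v hv => ?_
             zero_mem' := fun v _ => ?_
             smul_mem' := fun c f hf v hv => ?_ }, fun g f hf v hv => ?_⟩, ?_, ?_⟩
  · rw [← conj_fischer, fischer_add_left, map_add, conj_fischer, conj_fischer, hf v hv, hg v hv,
      add_zero]
  · simp [fischer]
  · rw [fischer_smul_right, hf v hv, mul_zero]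
  · have : fischer (glRep n k (conjGL g) v) f = 0 := hf _ (V.apply_mem_toSubmodule _ hv)
    rw [← conj_fischer, fischer_glRep, conj_fischer, this]
  · rw [eq_bot_iff]
    exact fun f hf => eq_zero_of_fischer_self (hf.2 f hf.1)
  · rw [eq_top_iff]
    intro f _
    obtain ⟨p, hp, hq⟩ := exists_fischer_orthogonal V.toSubmodule f
    rw [← add_sub_cancel p f]
    exact Submodule.add_mem_sup hp hq

/-! ### Multihomogeneous components -/

theorem polyAction_diag_monomial (n k : ℕ) (t : Fin k → ℂˣ) (E : Fin n × Fin k →₀ ℕ) (c : ℂ) :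
    polyAction n k (1, diagGL t) (monomial E c) =
      (∏ j, (t j : ℂ) ^ ∑ i, E (i, j)) • monomial E c := by
  refine poly_funext fun M => ?_
  change eval _ (polyActionHom n k _ _ _) = _
  rw [eval_polyActionHom, smul_eval, eval_monomial, eval_monomial, Finsupp.prod_fintype _ _
    (by simp), Finsupp.prod_fintype _ _ (by simp), mul_left_comm, ← Finset.prod_congr rfl
    fun j _ => Finset.prod_pow_eq_pow_sum Finset.univ (fun i => E (i, j)) (t j : ℂ)]
  congr 1
  rw [Fintype.prod_prod_type_right, Fintype.prod_prod_type_right, ← Finset.prod_mul_distrib]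
  refine Finset.prod_congr rfl fun j _ => ?_
  rw [← Finset.prod_mul_distrib]
  refine Finset.prod_congr rfl fun i _ => ?_
  rw [← mul_pow, mul_comm (t j : ℂ)]
  congr 1
  simp [diagGL, mul_diagonal]

theorem coeff_polyAction_diag (n k : ℕ) (t : Fin k → ℂˣ) (E : Fin n × Fin k →₀ ℕ)
    (f : Poly n k) :
    coeff E (polyAction n k (1, diagGL t) f) =
      (∏ j, (t j : ℂ) ^ ∑ i, E (i, j)) * coeff E f := by
  classical
  induction f using MvPolynomial.induction_on' with
  | monomial F c =>
    rw [polyAction_diag_monomial, coeff_smul, smul_eq_mul, coeff_monomial]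
    split_ifs with h
    · rw [h]
    · simp
  | add p q hp hq => rw [map_add, coeff_add, hp, hq, coeff_add, mul_add]

/-- A polynomial is multihomogeneous of degree `d` iff this is so for each of its monomials. -/
theorem mem_multiComponent_iff {n k : ℕ} {d : Fin k → ℕ} {f : Poly n k} :
    f ∈ multiComponent n k d ↔ ∀ E ∈ f.support, ∀ j, ∑ i, E (i, j) = d j := by
  constructor
  · intro hf E hE j
    -- Testing with the torus element that is `2` at `j` and `1` elsewhere compares powers of `2`
    -- and so isolates the degree in column `j`.
    have h := congrArg (coeff E)
      (hf (Function.update 1 j (Units.mk0 (2 : ℂ) two_ne_zero)))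
    rw [coeff_polyAction_diag, coeff_smul, smul_eq_mul] at h
    have h' := mul_right_cancel₀ (mem_support_iff.1 hE) h
    rw [Finset.prod_eq_single j, Finset.prod_eq_single j] at h'
    · simp only [Function.update_self, Units.val_mk0] at h'
      exact Nat.pow_right_injective le_rfl (by exact_mod_cast h')
    · intro b _ hb
      simp [Function.update_of_ne hb]
    · simp
    · intro b _ hb
      simp [Function.update_of_ne hb]
    · simp
  · intro h t
    ext E
    rw [coeff_polyAction_diag, coeff_smul, smul_eq_mul]
    by_cases hE : E ∈ f.support
    · simp only [h E hE]
    · rw [notMem_support_iff.1 hE, mul_zero, mul_zero]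

theorem mem_Qdeg_iff {n k m : ℕ} {f : Poly n k} :
    f ∈ Qdeg n k m ↔ ∀ E ∈ f.support, ∀ j, ∑ i, E (i, j) = m :=
  mem_multiComponent_iff

theorem monomial_mem_Qdeg {n k m : ℕ} {E : Fin n × Fin k →₀ ℕ} (h : ∀ j, ∑ i, E (i, j) = m)
    (c : ℂ) : monomial E c ∈ Qdeg n k m := by
  rw [mem_Qdeg_iff]
  intro F hF
  rw [Finset.mem_singleton.1 (support_monomial_subset hF)]
  exact h

theorem mul_mem_multiComponent {n k : ℕ} {d e : Fin k → ℕ} {f g : Poly n k}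
    (hf : f ∈ multiComponent n k d) (hg : g ∈ multiComponent n k e) :
    f * g ∈ multiComponent n k (d + e) := by
  classical
  rw [mem_multiComponent_iff] at *
  intro E hE j
  obtain ⟨F, hF, G, hG, rfl⟩ := Finset.mem_add.1 (support_mul f g hE)
  simp [Finset.sum_add_distrib, hf F hF j, hg G hG j]

theorem pow_mem_multiComponent {n k : ℕ} {d : Fin k → ℕ} {f : Poly n k}
    (hf : f ∈ multiComponent n k d) (a : ℕ) : f ^ a ∈ multiComponent n k (a • d) := by
  induction a with
  | zero =>
    rw [mem_multiComponent_iff]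
    intro E hE j
    rw [pow_zero, ← C_1, C_apply] at hE
    rw [Finset.mem_singleton.1 (support_monomial_subset hE)]
    simp
  | succ a ih => rw [pow_succ, succ_nsmul]; exact mul_mem_multiComponent ih hf

theorem X_mem_multiComponent {n k : ℕ} (i : Fin n) (j : Fin k) :
    (X (i, j) : Poly n k) ∈ multiComponent n k (Pi.single j 1) := by
  classical
  rw [mem_multiComponent_iff]
  intro E hE j'
  rw [Finset.mem_singleton.1 (support_monomial_subset hE)]
  by_cases h : j' = j
  · subst h
    simp [Finsupp.single_apply]
  · simp [h]

instance finiteDimensional_Qdeg (n k m : ℕ) : FiniteDimensional ℂ (Qdeg n k m) := by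
  -- Each exponent is bounded by the degree `m` of its column.
  have hfin : Set.Finite {E : Fin n × Fin k →₀ ℕ | ∀ j, ∑ i, E (i, j) = m} := by
    refine Set.Finite.subset (Set.finite_Iic (Finsupp.equivFunOnFinite.symm fun _ => m)) ?_
    intro E hE p
    rw [← hE p.2]
    exact Finset.single_le_sum (f := fun i => E (i, p.2)) (fun _ _ => Nat.zero_le _)
      (Finset.mem_univ p.1)
  have : Finite {E : Fin n × Fin k →₀ ℕ | ∀ j, ∑ i, E (i, j) = m} := hfin
  have : FiniteDimensional ℂ
      (restrictSupport ℂ {E : Fin n × Fin k →₀ ℕ | ∀ j, ∑ i, E (i, j) = m}) :=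
    (basisRestrictSupport ℂ _).finiteDimensional_of_finite
  have hle : Qdeg n k m ≤ restrictSupport ℂ {E : Fin n × Fin k →₀ ℕ | ∀ j, ∑ i, E (i, j) = m} :=
    fun f hf E hE => mem_Qdeg_iff.1 hf E hE
  exact Submodule.finiteDimensional_of_le hle

theorem glRep_mem_Qdeg {n k m : ℕ} (g : GL (Fin n) ℂ) {f : Poly n k} (hf : f ∈ Qdeg n k m) :
    glRep n k g f ∈ Qdeg n k m := fun t => by
  rw [polyAction_eq_comp, hf t, map_smul]

/-! ### Vectors fixed by `U_n` in stable subspaces -/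

/-- The monomials of weight at least `r`, where the variable `x_{ij}` has weight `n - i`. -/
def highWeight (n k r : ℕ) : Submodule ℂ (Poly n k) :=
  restrictSupport ℂ {E | r ≤ ∑ p, E p * (n - p.1)}

theorem mul_mem_highWeight {n k r s : ℕ} {f g : Poly n k} (hf : f ∈ highWeight n k r)
    (hg : g ∈ highWeight n k s) : f * g ∈ highWeight n k (r + s) := by
  classical
  intro E hE
  obtain ⟨F, hF, G, hG, rfl⟩ := Finset.mem_add.1 (support_mul f g hE)
  have h1 := hf hF
  have h2 := hg hG
  simp only [Set.mem_ofPred_eq] at h1 h2 ⊢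
  simp only [Finsupp.add_apply, add_mul, Finset.sum_add_distrib]
  exact add_le_add h1 h2

theorem highWeight_anti {n k : ℕ} : Antitone (highWeight n k) := fun _ _ h =>
  restrictSupport_mono _ fun _ hE => h.trans hE

theorem X_mem_highWeight {n k : ℕ} (i : Fin n) (j : Fin k) :
    (X (i, j) : Poly n k) ∈ highWeight n k (n - i) := by
  classical
  intro E hE
  rw [Finset.mem_singleton.1 (support_monomial_subset hE)]
  simp [Finsupp.single_apply]

/-- The correction terms are multiples of `x_{sj}` with `s < i`, since `u` is upper triangular, and
a smaller row index means a larger weight. -/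
theorem glRep_X_sub_mem_highWeight {n k : ℕ} {u : GL (Fin n) ℂ} (hu : IsUnipotentUpper u)
    (i : Fin n) (j : Fin k) :
    glRep n k u (X (i, j)) - X (i, j) ∈ highWeight n k (n - i + 1) := by
  rw [glRep_X, ← Finset.add_sum_erase _ _ (Finset.mem_univ i), hu.2, C_1, one_mul,
    add_sub_cancel_left]
  refine Submodule.sum_mem _ fun s hs => ?_
  rw [← smul_eq_C_mul]
  rcases lt_or_gt_of_ne (Finset.ne_of_mem_erase hs) with h | h
  · refine Submodule.smul_mem _ _ (highWeight_anti ?_ (X_mem_highWeight s j))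
    have := i.isLt
    have : (s : ℕ) < i := h
    omega
  · rw [hu.1 s i h, zero_smul]
    exact Submodule.zero_mem _

/-- With `a = u.f - f` and `b = u.g - g`, the difference for the product is `a g + f b + a b`, and
every term has gained at least one in weight. -/
theorem glRep_mul_sub_mem_highWeight {n k r s : ℕ} {u : GL (Fin n) ℂ} {f g : Poly n k}
    (hf : f ∈ highWeight n k r ∧ glRep n k u f - f ∈ highWeight n k (r + 1))
    (hg : g ∈ highWeight n k s ∧ glRep n k u g - g ∈ highWeight n k (s + 1)) :
    f * g ∈ highWeight n k (r + s) ∧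
      glRep n k u (f * g) - f * g ∈ highWeight n k (r + s + 1) := by
  refine ⟨mul_mem_highWeight hf.1 hg.1, ?_⟩
  have h1 := mul_mem_highWeight hf.2 hg.1
  have h2 := mul_mem_highWeight hf.1 hg.2
  rw [show r + 1 + s = r + s + 1 by ring] at h1
  have h3 : (glRep n k u f - f) * (glRep n k u g - g) ∈ highWeight n k (r + s + 1) :=
    highWeight_anti (by omega) (mul_mem_highWeight hf.2 hg.2)
  convert Submodule.add_mem _ (Submodule.add_mem _ h1 h2) h3 using 1
  rw [glRep_mul]
  ring

theorem glRep_monomial_sub_mem_highWeight {n k : ℕ} {u : GL (Fin n) ℂ} (hu : IsUnipotentUpper u)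
    (E : Fin n × Fin k →₀ ℕ) :
    monomial E (1 : ℂ) ∈ highWeight n k (∑ p, E p * (n - p.1)) ∧
      glRep n k u (monomial E 1) - monomial E 1 ∈
        highWeight n k ((∑ p, E p * (n - p.1)) + 1) := by
  classical
  have hone : (1 : Poly n k) ∈ highWeight n k 0 ∧
      glRep n k u 1 - 1 ∈ highWeight n k (0 + 1) := by
    refine ⟨fun E _ => Nat.zero_le _, ?_⟩
    rw [← C_1, glRep_C, sub_self]
    exact Submodule.zero_mem _
  induction E using Finsupp.induction_linear with
  | zero => simpa using hone
  | add E F hE hF =>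
    have := glRep_mul_sub_mem_highWeight hE hF
    rw [monomial_mul, one_mul] at this
    simpa only [Finsupp.add_apply, add_mul, Finset.sum_add_distrib] using this
  | single p a =>
    obtain ⟨i, j⟩ := p
    rw [← X_pow_eq_monomial]
    simp only [Finsupp.single_apply, ite_mul, zero_mul, Finset.sum_ite_eq, Finset.mem_univ,
      if_true]
    induction a with
    | zero => simpa using hone
    | succ a ih =>
      rw [pow_succ, add_mul, one_mul]
      exact glRep_mul_sub_mem_highWeight ih
        ⟨X_mem_highWeight i j, glRep_X_sub_mem_highWeight hu i j⟩

theorem glRep_sub_mem_highWeight {n k r : ℕ} {u : GL (Fin n) ℂ} (hu : IsUnipotentUpper u)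
    {f : Poly n k} (hf : f ∈ highWeight n k r) :
    glRep n k u f - f ∈ highWeight n k (r + 1) := by
  rw [f.as_sum, map_sum, ← Finset.sum_sub_distrib]
  refine Submodule.sum_mem _ fun E hE => ?_
  rw [← mul_one (coeff E f), ← smul_eq_mul, ← smul_monomial, map_smul, ← smul_sub]
  exact Submodule.smul_mem _ _ (highWeight_anti (Nat.succ_le_succ (hf hE))
    (glRep_monomial_sub_mem_highWeight hu E).2)

/-- Each nonzero stable subspace of `𝒬_m` contains a nonzero vector fixed by `U_n`. -/
theorem exists_unInvariant {n k m : ℕ} (V : Subrepresentation (glRep n k))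
    (hV : V.toSubmodule ≤ Qdeg n k m) (h0 : V.toSubmodule ≠ ⊥) :
    ∃ f ∈ V.toSubmodule, f ≠ 0 ∧ f ∈ unInvariants (glRep n k) := by
  classical
  -- The weights occurring in `𝒬_m` are bounded, so there is a largest `r` for which `V` contains a
  -- nonzero `f` of weight at least `r`. If some `u` moved `f`, then `u.f - f` would contradict the
  -- maximality of `r`.
  let P : ℕ → Prop := fun r => ∃ f ∈ V.toSubmodule, f ≠ 0 ∧ f ∈ highWeight n k r
  have hbound : ∀ r, P r → r ≤ k * (m * n) := by
    rintro r ⟨f, hfV, hf0, hf⟩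
    obtain ⟨E, hE⟩ := support_nonempty.2 hf0
    have h1 : r ≤ ∑ p, E p * (n - p.1) := hf hE
    refine h1.trans ?_
    calc ∑ p : Fin n × Fin k, E p * (n - p.1) ≤ ∑ p : Fin n × Fin k, E p * n :=
          Finset.sum_le_sum fun p _ => Nat.mul_le_mul_left _ (Nat.sub_le _ _)
      _ = ∑ j : Fin k, m * n := by
          rw [Fintype.sum_prod_type_right]
          refine Finset.sum_congr rfl fun j _ => ?_
          rw [← Finset.sum_mul, mem_Qdeg_iff.1 (hV hfV) E hE j]
      _ = k * (m * n) := by simp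
  have hP0 : P 0 := by
    obtain ⟨f, hf, hf0⟩ := (Submodule.ne_bot_iff _).1 h0
    exact ⟨f, hf, hf0, fun E _ => Nat.zero_le _⟩
  obtain ⟨f, hfV, hf0, hf⟩ := Nat.findGreatest_spec (P := P) (Nat.zero_le (k * (m * n))) hP0
  refine ⟨f, hfV, hf0, fun u hu => ?_⟩
  by_contra hne
  have hP : P (Nat.findGreatest P (k * (m * n)) + 1) :=
    ⟨_, V.toSubmodule.sub_mem (V.apply_mem_toSubmodule u hfV) hfV, sub_ne_zero.2 hne,
      glRep_sub_mem_highWeight hu hf⟩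
  exact absurd (Nat.le_findGreatest (hbound _ hP) hP) (by omega)

/-! ### The vectors `α^(m-a) γ^a` -/

section TwoColumns

variable {n : ℕ} (hn : 2 ≤ n)

/-- The vector `α^(m-a) γ^a`. -/
abbrev hwv (m a : ℕ) : Poly n 2 := alpha n hn ^ (m - a) * gamma n hn ^ a

theorem gamma_eq : gamma n hn = X (⟨0, by omega⟩, 0) * X (⟨1, by omega⟩, 1) -
    X (⟨0, by omega⟩, 1) * X (⟨1, by omega⟩, 0) := by
  rw [gamma, det_fin_two_of]

theorem gamma_ne_zero : gamma n hn ≠ 0 := by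
  intro h
  have := congrArg (eval fun x : Fin n × Fin 2 => if (x.1 : ℕ) = x.2 then (1 : ℂ) else 0) h
  simp [gamma_eq] at this

theorem alpha_ne_zero : alpha n hn ≠ 0 := mul_ne_zero (X_ne_zero _) (X_ne_zero _)

theorem hwv_ne_zero (m a : ℕ) : hwv hn m a ≠ 0 :=
  mul_ne_zero (pow_ne_zero _ (alpha_ne_zero hn)) (pow_ne_zero _ (gamma_ne_zero hn))

theorem glRep_diag_X (k : ℕ) (t : Fin n → ℂˣ) (i : Fin n) (j : Fin k) :
    glRep n k (diagGL t) (X (i, j)) = (t i : ℂ) • X (i, j) := by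
  rw [glRep_X, Finset.sum_eq_single i]
  · simp [diagGL, smul_eq_C_mul]
  · intro s _ hs
    simp [diagGL, diagonal_apply_ne _ hs]
  · simp

theorem glRep_diag_alpha (t : Fin n → ℂˣ) :
    glRep n 2 (diagGL t) (alpha n hn) = ((t ⟨0, by omega⟩ : ℂ) ^ 2) • alpha n hn := by
  rw [alpha, glRep_mul, glRep_diag_X, glRep_diag_X, smul_mul_smul_comm, sq]

theorem glRep_diag_gamma (t : Fin n → ℂˣ) :
    glRep n 2 (diagGL t) (gamma n hn) =
      ((t ⟨0, by omega⟩ : ℂ) * t ⟨1, by omega⟩) • gamma n hn := by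
  simp only [gamma_eq, map_sub, glRep_mul, glRep_diag_X, smul_mul_smul_comm, smul_sub]

theorem glRep_diag_hwv {m a : ℕ} (h : a ≤ m) (t : Fin n → ℂˣ) :
    glRep n 2 (diagGL t) (hwv hn m a) =
      ((t ⟨0, by omega⟩ : ℂ) ^ (2 * m - a) * (t ⟨1, by omega⟩ : ℂ) ^ a) • hwv hn m a := by
  rw [glRep_mul, glRep_pow, glRep_pow, glRep_diag_alpha, glRep_diag_gamma, smul_pow, smul_pow,
    smul_mul_smul_comm, mul_pow, ← pow_mul, ← mul_assoc, ← pow_add]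
  congr 4
  omega

theorem glRep_unipotent_X_zero {u : GL (Fin n) ℂ} (hu : IsUnipotentUpper u) (j : Fin 2) :
    glRep n 2 u (X (⟨0, by omega⟩, j)) = X (⟨0, by omega⟩, j) := by
  rw [glRep_X, Finset.sum_eq_single ⟨0, by omega⟩]
  · rw [hu.2, C_1, one_mul]
  · intro s _ hs
    rw [hu.1 s _ (Fin.lt_def.2 (Nat.pos_of_ne_zero fun h => hs (Fin.ext h))), C_0, zero_mul]
  · simp

theorem glRep_unipotent_X_one {u : GL (Fin n) ℂ} (hu : IsUnipotentUpper u) (j : Fin 2) :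
    glRep n 2 u (X (⟨1, by omega⟩, j)) = X (⟨1, by omega⟩, j) +
      C ((u : Matrix (Fin n) (Fin n) ℂ) ⟨0, by omega⟩ ⟨1, by omega⟩) * X (⟨0, by omega⟩, j) := by
  rw [glRep_X, Finset.sum_eq_add (⟨1, by omega⟩ : Fin n) ⟨0, by omega⟩ (by simp)]
  · rw [hu.2, C_1, one_mul]
  · intro s _ hs
    have : (⟨1, by omega⟩ : Fin n) < s := by
      rw [Fin.lt_def]
      have h1 : (s : ℕ) ≠ 1 := fun h => hs.1 (Fin.ext h)
      have h0 : (s : ℕ) ≠ 0 := fun h => hs.2 (Fin.ext h)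
      simp only
      omega
    rw [hu.1 s _ this, C_0, zero_mul]
  · simp
  · simp

theorem alpha_mem_unInvariants : alpha n hn ∈ unInvariants (glRep n 2) := fun u hu => by
  rw [alpha, glRep_mul, glRep_unipotent_X_zero hn hu, glRep_unipotent_X_zero hn hu]

theorem gamma_mem_unInvariants : gamma n hn ∈ unInvariants (glRep n 2) := fun u hu => by
  simp only [gamma_eq, map_sub, glRep_mul, glRep_unipotent_X_zero hn hu,
    glRep_unipotent_X_one hn hu]
  ring

theorem alpha_pow_mul_gamma_pow_mem_unInvariants (i j : ℕ) :
    alpha n hn ^ i * gamma n hn ^ j ∈ unInvariants (glRep n 2) := fun u hu => by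
  rw [glRep_mul, glRep_pow, glRep_pow, alpha_mem_unInvariants hn u hu,
    gamma_mem_unInvariants hn u hu]

theorem alpha_pow_mul_gamma_pow_mem_Qdeg (i j : ℕ) :
    alpha n hn ^ i * gamma n hn ^ j ∈ Qdeg n 2 (i + j) := by
  have h01 : (Pi.single 0 1 + Pi.single 1 1 : Fin 2 → ℕ) = fun _ => 1 := by
    ext x; fin_cases x <;> simp
  have hα : alpha n hn ∈ multiComponent n 2 fun _ => 1 := by
    rw [← h01]
    exact mul_mem_multiComponent (X_mem_multiComponent _ _) (X_mem_multiComponent _ _)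
  have hγ : gamma n hn ∈ multiComponent n 2 fun _ => 1 := by
    rw [gamma_eq, ← h01]
    refine Submodule.sub_mem _
      (mul_mem_multiComponent (X_mem_multiComponent _ _) (X_mem_multiComponent _ _)) ?_
    rw [add_comm (Pi.single 0 1 : Fin 2 → ℕ)]
    exact mul_mem_multiComponent (X_mem_multiComponent _ _) (X_mem_multiComponent _ _)
  have := mul_mem_multiComponent (pow_mem_multiComponent hα i) (pow_mem_multiComponent hγ j)
  convert this using 1
  rw [Qdeg]
  congr 1
  ext x
  simp

theorem hwv_mem_Qdeg {m a : ℕ} (h : a ≤ m) : hwv hn m a ∈ Qdeg n 2 m := by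
  have := alpha_pow_mul_gamma_pow_mem_Qdeg hn (m - a) a
  rwa [Nat.sub_add_cancel h] at this

theorem symRep_swap_alpha : symRep n 2 (Equiv.swap 0 1) (alpha n hn) = alpha n hn := by
  change rename _ _ = _
  simp only [alpha, map_mul, rename_X, Prod.map_apply, id_eq, Equiv.swap_apply_left,
    Equiv.swap_apply_right]
  rw [mul_comm]

theorem symRep_swap_gamma : symRep n 2 (Equiv.swap 0 1) (gamma n hn) = -gamma n hn := by
  change rename _ _ = _
  simp only [gamma_eq, map_sub, map_mul, rename_X, Prod.map_apply, id_eq,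
    Equiv.swap_apply_left, Equiv.swap_apply_right]
  ring

theorem symRep_swap_pow (i j : ℕ) :
    symRep n 2 (Equiv.swap 0 1) (alpha n hn ^ i * gamma n hn ^ j) =
      (-1 : ℂ) ^ j • (alpha n hn ^ i * gamma n hn ^ j) := by
  have h1 := symRep_swap_alpha hn
  have h2 := symRep_swap_gamma hn
  change rename _ _ = _ at h1 h2
  change rename _ _ = _
  rw [map_mul, map_pow, map_pow, h1, h2, neg_pow, smul_eq_C_mul]
  simp only [map_pow, map_neg, map_one]
  ring

/-! ### Invariants of `U_n` by reduction to upper triangular matrices -/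

/-- A monomial survives on these matrices only if it involves no variable besides `x_{11}`, `x_{12}`
and `x_{22}`. The degree of the first column then forces `x^m`, and that of the second forces
`y^(m-a) z^a` with `a` the exponent of `x_{22}`. -/
theorem eval_reduced (hn : 2 ≤ n) (m : ℕ) (E : Fin n × Fin 2 →₀ ℕ) (hE : ∀ j, ∑ i, E (i, j) = m) (b : ℂ) :
    ∃ c : ℕ → ℂ, ∀ x y z : ℂ,
      eval (fun p : Fin n × Fin 2 => if (p.1 : ℕ) = 0 then (if p.2 = 0 then x else y) else
        if (p.1 : ℕ) = 1 ∧ p.2 = 1 then z else 0) (monomial E b) =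
      ∑ a ∈ Finset.range (m + 1), c a * (x ^ m * y ^ (m - a) * z ^ a) := by
  obtain ⟨n, rfl⟩ := Nat.exists_eq_add_of_le' hn
  have h0 := hE 0
  have h1 := hE 1
  simp only [Fin.sum_univ_succ (n := n + 1), Fin.sum_univ_succ (n := n)] at h0 h1
  by_cases hz : E (1, 0) = 0 ∧ ∀ i : Fin n, ∀ j, E (i.succ.succ, j) = 0
  · refine ⟨fun a => if a = E (1, 1) then b else 0, fun x y z => ?_⟩
    have e0 : E (0, 0) = m := by simpa [hz.2, hz.1] using h0
    have e1 : E (0, 1) + E (1, 1) = m := by simpa [hz.2] using h1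
    simp only [ite_mul, zero_mul, Finset.sum_ite_eq', Finset.mem_range]
    rw [if_pos (by omega), eval_monomial, Finsupp.prod_fintype _ _ (by simp),
      Fintype.prod_prod_type_right]
    simp only [Fin.prod_univ_succ (n := n + 1), Fin.prod_univ_succ (n := n), Fin.prod_univ_two]
    simp [hz.2, hz.1, e0, show m - E (1, 1) = E (0, 1) by omega, mul_assoc]
  · refine ⟨0, fun x y z => ?_⟩
    -- Otherwise a variable whose value is zero occurs, and the monomial vanishes.
    have : ∃ p : Fin (n + 2) × Fin 2, E p ≠ 0 ∧ (p.1 : ℕ) ≠ 0 ∧ ¬((p.1 : ℕ) = 1 ∧ p.2 = 1) := by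
      by_contra! hcon
      refine hz ⟨?_, fun i j => ?_⟩
      · by_contra h
        simpa using hcon (1, 0) h
      · by_contra h
        simpa using hcon (i.succ.succ, j) h
    obtain ⟨p, hp, hp0, hp1⟩ := this
    rw [eval_monomial, Finsupp.prod_fintype _ _ (by simp), Finset.prod_eq_zero (Finset.mem_univ p)]
    · simp
    · rw [if_neg hp0, if_neg hp1, zero_pow hp]

theorem exists_eval_reduced (hn : 2 ≤ n) {m : ℕ} {f : Poly n 2} (hf : f ∈ Qdeg n 2 m) :
    ∃ c : ℕ → ℂ, ∀ x y z : ℂ,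
      eval (fun p : Fin n × Fin 2 => if (p.1 : ℕ) = 0 then (if p.2 = 0 then x else y) else
        if (p.1 : ℕ) = 1 ∧ p.2 = 1 then z else 0) f =
      ∑ a ∈ Finset.range (m + 1), c a * (x ^ m * y ^ (m - a) * z ^ a) := by
  choose! c hc using fun E (hE : E ∈ f.support) =>
    eval_reduced hn m E (mem_Qdeg_iff.1 hf E hE) (coeff E f)
  refine ⟨fun a => ∑ E ∈ f.support, c E a, fun x y z => ?_⟩
  conv_lhs => rw [f.as_sum, map_sum]
  rw [Finset.sum_congr rfl fun E hE => hc E hE x y z, Finset.sum_comm]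
  exact Finset.sum_congr rfl fun a _ => by rw [Finset.sum_mul]

/-- A lower triangular unipotent matrix which reduces a generic `n × 2` matrix to upper triangular
form. -/
def reducer (M : Matrix (Fin n) (Fin 2) ℂ) : Matrix (Fin n) (Fin n) ℂ :=
  Matrix.of fun i j =>
    if (j : ℕ) = 0 then M i 0 / M ⟨0, by omega⟩ 0
    else if (j : ℕ) = 1 then
      (M i 1 * M ⟨0, by omega⟩ 0 - M i 0 * M ⟨0, by omega⟩ 1) /
        (M ⟨0, by omega⟩ 0 * M ⟨1, by omega⟩ 1 - M ⟨0, by omega⟩ 1 * M ⟨1, by omega⟩ 0)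
    else if i = j then 1 else 0

theorem reducer_diag {M : Matrix (Fin n) (Fin 2) ℂ} (h0 : M ⟨0, by omega⟩ 0 ≠ 0)
    (h1 : M ⟨0, by omega⟩ 0 * M ⟨1, by omega⟩ 1 - M ⟨0, by omega⟩ 1 * M ⟨1, by omega⟩ 0 ≠ 0)
    (i : Fin n) : reducer hn M i i = 1 := by
  rcases i with ⟨_ | _ | i, hi⟩
  · simp only [reducer, of_apply, if_true]
    exact div_self h0
  · simp only [reducer, of_apply, if_true, zero_add, one_ne_zero, if_false]
    rw [div_eq_one_iff_eq h1]
    ring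
  · simp [reducer]

theorem reducer_lower {M : Matrix (Fin n) (Fin 2) ℂ} {i j : Fin n} (h : i < j) :
    reducer hn M i j = 0 := by
  rcases j with ⟨_ | _ | j, hj⟩
  · exact absurd (Fin.lt_def.1 h) (Nat.not_lt_zero _)
  · have : i = ⟨0, by omega⟩ := Fin.ext (by have := Fin.lt_def.1 h; simp only at this ⊢; omega)
    rw [this]
    simp only [reducer, of_apply, if_true, zero_add, one_ne_zero, if_false]
    rw [mul_comm, sub_self, zero_div]
  · simp [reducer, h.ne]

/-- This is Gaussian elimination written as a factorization: the first column of the reducer clears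
column one below the pivot, and its second column, made of ratios of `2 × 2` minors, clears column
two below row two. -/
theorem reducer_mul {M : Matrix (Fin n) (Fin 2) ℂ} (h0 : M ⟨0, by omega⟩ 0 ≠ 0)
    (h1 : M ⟨0, by omega⟩ 0 * M ⟨1, by omega⟩ 1 - M ⟨0, by omega⟩ 1 * M ⟨1, by omega⟩ 0 ≠ 0) :
    reducer hn M * Matrix.of (fun (i : Fin n) (j : Fin 2) => if (i : ℕ) = 0 then
        (if j = 0 then M ⟨0, by omega⟩ 0 else M ⟨0, by omega⟩ 1) else
        if (i : ℕ) = 1 ∧ j = 1 then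
        (M ⟨0, by omega⟩ 0 * M ⟨1, by omega⟩ 1 - M ⟨0, by omega⟩ 1 * M ⟨1, by omega⟩ 0) /
          M ⟨0, by omega⟩ 0 else 0) = M := by
  ext i j
  rw [mul_apply, Finset.sum_eq_add (⟨0, by omega⟩ : Fin n) ⟨1, by omega⟩ (by simp)]
  · fin_cases j
    · simp [reducer, h0]
    · simp [reducer]
      field_simp
      ring
  · intro s _ hs
    have h1 : (s : ℕ) ≠ 1 := fun h => hs.2 (Fin.ext h)
    have h0 : (s : ℕ) ≠ 0 := fun h => hs.1 (Fin.ext h)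
    simp [h0, h1]
  · simp
  · simp

theorem exists_unipotent_reducer {M : Matrix (Fin n) (Fin 2) ℂ} (h0 : M ⟨0, by omega⟩ 0 ≠ 0)
    (h1 : M ⟨0, by omega⟩ 0 * M ⟨1, by omega⟩ 1 - M ⟨0, by omega⟩ 1 * M ⟨1, by omega⟩ 0 ≠ 0) :
    ∃ u : GL (Fin n) ℂ, IsUnipotentUpper u ∧
      (u : Matrix (Fin n) (Fin n) ℂ)ᵀ = reducer hn M := by
  have hdet : (reducer hn M)ᵀ.det = 1 := by
    rw [det_of_isUpperTriangular, Finset.prod_eq_one]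
    · exact fun i _ => reducer_diag hn h0 h1 i
    · exact fun i j h => reducer_lower hn h
  refine ⟨GeneralLinearGroup.mkOfDetNeZero (reducer hn M)ᵀ (by simp [hdet]), ⟨?_, ?_⟩, ?_⟩
  · exact fun i j h => reducer_lower hn h
  · exact fun i => reducer_diag hn h0 h1 i
  · exact transpose_transpose _

/-- The `U_n`-invariants in `𝒬_m`. -/
theorem exists_eq_sum_hwv {m : ℕ} {f : Poly n 2} (hf : f ∈ Qdeg n 2 m)
    (hu : f ∈ unInvariants (glRep n 2)) :
    ∃ c : ℕ → ℂ, f = ∑ a ∈ Finset.range (m + 1), c a • hwv hn m a := by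
  obtain ⟨c, hc⟩ := exists_eval_reduced hn hf
  refine ⟨c, ?_⟩
  -- Elimination needs `x_{11}` and `γ` to be nonzero. Multiplying the claimed identity by `x_{11}
  -- γ` makes it trivial on the remaining matrices, and this factor can be cancelled in the domain
  -- of polynomials.
  have hne : X (⟨0, by omega⟩, 0) * gamma n hn ≠ 0 := mul_ne_zero (X_ne_zero _) (gamma_ne_zero hn)
  refine mul_left_cancel₀ hne (poly_funext fun M => ?_)
  rw [map_mul (eval _) _ f, map_mul (eval _) _ (Finset.sum _ _)]
  by_cases h : eval (fun x : Fin n × Fin 2 => M x.1 x.2) (X (⟨0, by omega⟩, 0) * gamma n hn) = 0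
  · rw [h, zero_mul, zero_mul]
  · congr 1
    rw [← ne_eq, gamma_eq, map_mul, mul_ne_zero_iff] at h
    simp only [eval_X, map_sub, map_mul] at h
    obtain ⟨u, hu1, hu2⟩ := exists_unipotent_reducer hn h.1 h.2
    -- If `M = uᵗ B` with `B` the reduced matrix, then `f(M) = (u.f)(B) = f(B)` by invariance.
    have key := eval_glRep n 2 u f (Matrix.of fun i j => if (i : ℕ) = 0 then
        (if j = 0 then M ⟨0, by omega⟩ 0 else M ⟨0, by omega⟩ 1) else
        if (i : ℕ) = 1 ∧ j = 1 then
        (M ⟨0, by omega⟩ 0 * M ⟨1, by omega⟩ 1 - M ⟨0, by omega⟩ 1 * M ⟨1, by omega⟩ 0) /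
          M ⟨0, by omega⟩ 0 else 0)
    rw [hu2, reducer_mul hn h.1 h.2, hu u hu1] at key
    rw [← key]
    simp only [of_apply]
    rw [hc, map_sum]
    refine Finset.sum_congr rfl fun a ha => ?_
    rw [smul_eval]
    congr 1
    simp only [hwv, alpha, gamma_eq, map_mul, map_pow, map_sub, eval_X]
    -- Splitting `x^m` as `x^(m-a) x^a` cancels the denominator of `z^a = (γ/x)^a`.
    have hm : m = m - a + a := by
      have := Finset.mem_range.1 ha
      omega
    have h2 := h.1
    conv_lhs => rw [hm, Nat.add_sub_cancel]
    rw [pow_add, div_pow, mul_pow]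
    field_simp

end TwoColumns

/-! ### Equivariant maps -/

theorem algHom_glRep {n k l : ℕ} (φ : Poly n k →ₐ[ℂ] Poly n l)
    (h : ∀ g i j, φ (glRep n k g (X (i, j))) = glRep n l g (φ (X (i, j))))
    (g : GL (Fin n) ℂ) (f : Poly n k) : φ (glRep n k g f) = glRep n l g (φ f) := by
  induction f using MvPolynomial.induction_on with
  | C a => rw [glRep_C, algHom_C, algebraMap_eq, glRep_C]
  | add p q hp hq => simp only [map_add, hp, hq]
  | mul_X p x hp => rw [glRep_mul, map_mul, hp, h, map_mul, glRep_mul]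

/-- The inclusion of the polynomials in the first two columns. -/
def columnIncl {n : ℕ} (hn : 2 ≤ n) : Poly n 2 →ₐ[ℂ] Poly n n :=
  rename (Prod.map id (Fin.castLE hn))

theorem columnIncl_glRep {n : ℕ} (hn : 2 ≤ n) (g : GL (Fin n) ℂ) (f : Poly n 2) :
    columnIncl hn (glRep n 2 g f) = glRep n n g (columnIncl hn f) := by
  refine algHom_glRep _ (fun g i j => ?_) g f
  simp [columnIncl, glRep_X, map_sum, map_mul]

/-- The projection to the polynomials in the first two columns. -/
def columnProj (n : ℕ) : Poly n n →ₐ[ℂ] Poly n 2 :=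
  aeval fun p => if h : (p.2 : ℕ) < 2 then X (p.1, ⟨p.2, h⟩) else 0

theorem columnProj_X (n : ℕ) (i j : Fin n) :
    columnProj n (X (i, j)) = if h : (j : ℕ) < 2 then X (i, ⟨j, h⟩) else 0 :=
  aeval_X _ _

theorem columnProj_glRep (n : ℕ) (g : GL (Fin n) ℂ) (f : Poly n n) :
    columnProj n (glRep n n g f) = glRep n 2 g (columnProj n f) := by
  refine algHom_glRep _ (fun g i j => ?_) g f
  by_cases h : (j : ℕ) < 2
  · simp only [glRep_X, map_sum, map_mul, columnProj_X, dif_pos h, algHom_C, algebraMap_eq]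
  · simp only [glRep_X, map_sum, map_mul, columnProj_X, dif_neg h, mul_zero, map_zero,
      Finset.sum_const_zero]

theorem columnProj_columnIncl {n : ℕ} (hn : 2 ≤ n) (f : Poly n 2) :
    columnProj n (columnIncl hn f) = f := by
  have : (columnProj n).comp (columnIncl hn) = AlgHom.id ℂ _ := by
    refine MvPolynomial.algHom_ext fun p => ?_
    obtain ⟨i, j⟩ := p
    rw [AlgHom.comp_apply, columnIncl, rename_X]
    exact (columnProj_X n _ _).trans (dif_pos j.isLt)
  exact DFunLike.congr_fun this f

/-- The polarization operator `∑ i, x_{is} ∂/∂x_{it}`. -/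
def polarize (n : ℕ) {k : ℕ} (s t : Fin k) : Derivation ℂ (Poly n k) (Poly n k) :=
  mkDerivation ℂ fun p => if p.2 = t then X (p.1, s) else 0

theorem polarize_X {n k : ℕ} (s t : Fin k) (i : Fin n) (j : Fin k) :
    polarize n s t (X (i, j)) = if j = t then X (i, s) else 0 :=
  mkDerivation_X _ _ _

/-- Polarization mixes columns while `GL_n` mixes rows, so the two commute; by the Leibniz rule it
is enough to see this on variables. -/
theorem polarize_glRep {n k : ℕ} (s t : Fin k) (g : GL (Fin n) ℂ) (f : Poly n k) :
    polarize n s t (glRep n k g f) = glRep n k g (polarize n s t f) := by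
  induction f using MvPolynomial.induction_on with
  | C a => simp [glRep_C, derivation_C]
  | add p q hp hq => simp only [map_add, hp, hq]
  | mul_X p x hp =>
    obtain ⟨i, j⟩ := x
    have h1 : polarize n s t (glRep n k g (X (i, j))) = glRep n k g (polarize n s t (X (i, j))) := by
      rw [glRep_X, map_sum, polarize_X]
      simp only [Derivation.leibniz, polarize_X, derivation_C, smul_eq_mul, mul_zero, add_zero]
      split_ifs with h
      · rw [glRep_X]
      · simp
    simp only [glRep_mul, Derivation.leibniz, map_add, hp, h1, smul_eq_mul]

/-! ### Polarization of the vectors `α^(m-a) γ^a` and the representations `ρ_n^(2m-a,a)` -/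

section TwoColumns

variable {n : ℕ} (hn : 2 ≤ n)

/-- Polarizing a determinant replaces one column by the other, which leaves two equal columns. Thus
`γ` behaves as a constant below. -/
theorem polarize_gamma {s t : Fin 2} (h : s ≠ t) : polarize n s t (gamma n hn) = 0 := by
  rw [gamma_eq]
  simp only [map_sub, Derivation.leibniz, polarize_X, smul_eq_mul]
  fin_cases s <;> fin_cases t <;> simp at h ⊢ <;> ring

/-- The vector `x_{1s}^p x_{1t}^q γ^a`. -/
abbrev tvec (s t : Fin 2) (p q a : ℕ) : Poly n 2 :=
  X (⟨0, by omega⟩, s) ^ p * X (⟨0, by omega⟩, t) ^ q * gamma n hn ^ a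

/-- For `q = 0` the truncated exponent `q - 1` is harmless, because the coefficient `q` vanishes. -/
theorem polarize_tvec {s t : Fin 2} (h : s ≠ t) (p q a : ℕ) :
    polarize n s t (tvec hn s t p q a) = (q : ℂ) • tvec hn s t (p + 1) (q - 1) a := by
  simp only [tvec, Derivation.leibniz, Derivation.leibniz_pow, polarize_X, polarize_gamma hn h,
    if_neg h, if_true, smul_eq_mul, smul_zero, mul_zero, add_zero, zero_add]
  rw [smul_eq_C_mul, nsmul_eq_mul, map_natCast]
  ring

theorem tvec_swap (s t : Fin 2) (p q a : ℕ) : tvec hn s t p q a = tvec hn t s q p a := by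
  rw [tvec, tvec, mul_comm (X _ ^ p)]

theorem hwv_eq_tvec (m a : ℕ) : hwv hn m a = tvec hn 0 1 (m - a) (m - a) a := by
  rw [hwv, alpha, mul_pow]

/-- With `d = m - a`, the first operator brings down the exponent `d` and raises the other one to `d
+ 1`, which the second operator brings down. The eigenvalue `d (d + 1)` tells the different `a`
apart. -/
theorem polarize_polarize_hwv (m a : ℕ) :
    polarize n 0 1 (polarize n 1 0 (hwv hn m a)) =
      (((m - a) * (m - a + 1) : ℕ) : ℂ) • hwv hn m a := by
  rw [hwv_eq_tvec, tvec_swap, polarize_tvec hn (by decide), Derivation.map_smul, tvec_swap,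
    polarize_tvec hn (by decide), smul_smul, tvec_swap hn 1 0]
  rcases Nat.eq_zero_or_pos (m - a) with h | h
  · simp [h]
  · rw [Nat.sub_add_cancel h, Nat.add_sub_cancel]
    push_cast
    rfl

/-- Each application turns one factor `x_{1t}` into `x_{1s}`. The accumulated constant is `(q + 1) ⋯
(q + j)`, nonzero in characteristic zero. -/
theorem polarize_pow_tvec {s t : Fin 2} (h : s ≠ t) (q a : ℕ) : ∀ j p : ℕ, ∃ c : ℂ, c ≠ 0 ∧
    ((polarize n s t : Poly n 2 →ₗ[ℂ] Poly n 2) ^ j) (tvec hn s t p (q + j) a) =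
      c • tvec hn s t (p + j) q a := by
  intro j
  induction j with
  | zero => exact fun p => ⟨1, one_ne_zero, by simp⟩
  | succ j ih =>
    intro p
    obtain ⟨c, hc, h1⟩ := ih (p + 1)
    refine ⟨(q + (j + 1) : ℕ) * c, mul_ne_zero (Nat.cast_ne_zero.2 (by omega)) hc, ?_⟩
    rw [pow_succ, Module.End.mul_apply]
    have := polarize_tvec hn h p (q + (j + 1)) a
    rw [Nat.add_succ_sub_one] at this
    erw [this]
    rw [map_smul, h1, smul_smul, add_right_comm, add_assoc p]

theorem polarize_pow_glRep {s t : Fin 2} (j : ℕ) (g : GL (Fin n) ℂ) (f : Poly n 2) :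
    ((polarize n s t : Poly n 2 →ₗ[ℂ] Poly n 2) ^ j) (glRep n 2 g f) =
      glRep n 2 g (((polarize n s t : Poly n 2 →ₗ[ℂ] Poly n 2) ^ j) f) := by
  induction j generalizing f with
  | zero => simp
  | succ j ih =>
    rw [pow_succ, Module.End.mul_apply, Module.End.mul_apply, ← ih]
    exact congrArg _ (polarize_glRep s t g f)

theorem leadingMinor_zero : leadingMinor n ⟨0, by omega⟩ = X (⟨0, by omega⟩, ⟨0, by omega⟩) := by
  unfold leadingMinor
  exact det_fin_one _

theorem leadingMinor_one : leadingMinor n ⟨1, by omega⟩ = columnIncl hn (gamma n hn) := by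
  unfold leadingMinor
  refine (det_fin_two _).trans ?_
  simp only [gamma_eq, map_sub, map_mul, columnIncl, rename_X]
  rfl

/-- Only the first two leading minors occur, namely `x_{11}` and `γ`, with exponents `(2m - a) - a`
and `a`. -/
theorem minorProduct_diagram {m a : ℕ} (h : a ≤ m) :
    minorProduct n (diagram m a h) = columnIncl hn (tvec hn 0 1 (m - a + (m - a)) 0 a) := by
  unfold minorProduct diagram
  rw [Finset.prod_eq_mul (⟨0, by omega⟩ : Fin n) ⟨1, by omega⟩ (by simp)]
  · simp only [rowLen_twoRow, leadingMinor_zero hn, leadingMinor_one hn]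
    simp only [map_mul, map_pow, columnIncl, rename_X, pow_zero, mul_one, Prod.map_apply, id,
      if_true, zero_add, one_ne_zero, if_false]
    congr 2
    omega
  · intro i _ hi
    have h1 : (i : ℕ) ≠ 1 := fun h => hi.2 (Fin.ext h)
    have h0 : (i : ℕ) ≠ 0 := fun h => hi.1 (Fin.ext h)
    simp [rowLen_twoRow, h0, h1]
  · simp
  · simp

/-- The submodule generated by `α^(m-a) γ^a` is isomorphic to `ρ^(2m-a,a)`. -/
theorem nonempty_equiv_irrep {m a : ℕ} (h : a ≤ m) :
    Nonempty ((cyclic (glRep n 2) (hwv hn m a)).toRepresentation.Equiv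
      (irrep n (diagram m a h)).toRepresentation) := by
  -- Polarizing `m - a` times turns `α^(m-a) γ^a` into a multiple of `x_{11}^(2m-2a) γ^a`; the
  -- opposite polarization leads back.
  obtain ⟨c, hc, h1⟩ := polarize_pow_tvec hn (s := 0) (t := 1) (by decide) 0 a (m - a) (m - a)
  obtain ⟨d, hd, h2⟩ := polarize_pow_tvec hn (s := 1) (t := 0) (by decide) (m - a) a (m - a) 0
  rw [zero_add, ← hwv_eq_tvec] at h1
  rw [tvec_swap, zero_add, tvec_swap hn 1 0, ← hwv_eq_tvec] at h2
  refine ⟨cyclicEquiv (w := minorProduct n (diagram m a h))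
    (c⁻¹ • ((columnIncl hn).toLinearMap ∘ₗ
      ((polarize n (0 : Fin 2) 1 : Poly n 2 →ₗ[ℂ] Poly n 2) ^ (m - a)))) (fun g x => ?_) ?_
    (d⁻¹ • (((polarize n (1 : Fin 2) 0 : Poly n 2 →ₗ[ℂ] Poly n 2) ^ (m - a)) ∘ₗ
      (columnProj n).toLinearMap)) (fun g x => ?_) ?_⟩
  · simp only [LinearMap.smul_apply, LinearMap.comp_apply, AlgHom.toLinearMap_apply,
      polarize_pow_glRep, columnIncl_glRep, map_smul]
  · simp only [LinearMap.smul_apply, LinearMap.comp_apply, AlgHom.toLinearMap_apply, h1, map_smul,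
      minorProduct_diagram hn h, smul_smul, inv_mul_cancel₀ hc, one_smul]
  · simp only [LinearMap.smul_apply, LinearMap.comp_apply, AlgHom.toLinearMap_apply,
      polarize_pow_glRep, columnProj_glRep, map_smul]
  · simp only [LinearMap.smul_apply, LinearMap.comp_apply, AlgHom.toLinearMap_apply,
      minorProduct_diagram hn h, columnProj_columnIncl, h2, smul_smul, inv_mul_cancel₀ hd, one_smul]

/-! ### Highest weight vectors and irreducibility -/

/-- A diagonal matrix which separates the weights of the vectors `α^(m-a) γ^a` for fixed `m`. -/
def testTorus (n : ℕ) : Fin n → ℂˣ := fun i =>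
  if (i : ℕ) = 1 then Units.mk0 (2 : ℂ) two_ne_zero else 1

theorem testTorus_hwv {m a : ℕ} (h : a ≤ m) :
    glRep n 2 (diagGL (testTorus n)) (hwv hn m a) = ((2 : ℂ) ^ a) • hwv hn m a := by
  rw [glRep_diag_hwv hn h]
  simp [testTorus]

theorem two_pow_injective : Function.Injective fun a : ℕ => (2 : ℂ) ^ a := fun a b h =>
  Nat.pow_right_injective le_rfl (by
    simp only at h
    exact_mod_cast h)

theorem smul_hwv_mem {m : ℕ} {c : ℕ → ℂ} (V : Submodule ℂ (Poly n 2))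
    (hV : ∀ x ∈ V, glRep n 2 (diagGL (testTorus n)) x ∈ V)
    (h : ∑ a ∈ Finset.range (m + 1), c a • hwv hn m a ∈ V) {a : ℕ} (ha : a ≤ m) :
    c a • hwv hn m a ∈ V := by
  refine mem_of_sum_eigenvectors _ V hV (fun a => (2 : ℂ) ^ a) _ two_pow_injective.injOn
    (fun a => c a • hwv hn m a) (fun b hb => ?_) h a (Finset.mem_range.2 (by omega))
  rw [map_smul, testTorus_hwv hn (by have := Finset.mem_range.1 hb; omega), smul_comm]

/-- Multiplicity one: among the invariants in `𝒬_m`, an eigenvalue of the test torus element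
determines the vector up to a scalar. -/
theorem eq_smul_hwv {m a : ℕ} (ha : a ≤ m) {f : Poly n 2} (hf : f ∈ Qdeg n 2 m)
    (hu : f ∈ unInvariants (glRep n 2))
    (hw : glRep n 2 (diagGL (testTorus n)) f = ((2 : ℂ) ^ a) • f) :
    ∃ c : ℂ, f = c • hwv hn m a := by
  obtain ⟨c, rfl⟩ := exists_eq_sum_hwv hn hf hu
  refine ⟨c a, Finset.sum_eq_single a (fun b hb hba => ?_) fun h => ?_⟩
  · have hb' : b ≤ m := by have := Finset.mem_range.1 hb; omega
    -- The eigenspace itself serves as the stable subspace, so a component with `b ≠ a` has both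
    -- eigenvalues `2^a` and `2^b` and must vanish.
    have := smul_hwv_mem hn (Module.End.eigenspace (glRep n 2 (diagGL (testTorus n))) (2 ^ a))
      (fun x hx => by
        rw [Module.End.mem_eigenspace_iff] at hx ⊢
        rw [hx, map_smul, hx]) (Module.End.mem_eigenspace_iff.2 hw) hb'
    rw [Module.End.mem_eigenspace_iff, map_smul, testTorus_hwv hn hb', smul_comm, ← sub_eq_zero,
      ← sub_smul, smul_eq_zero] at this
    exact this.resolve_left (sub_ne_zero.2 fun h => hba (two_pow_injective h))
  · exact absurd (Finset.mem_range.2 (by omega)) h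

theorem exists_hwv_mem {m : ℕ} (V : Subrepresentation (glRep n 2))
    (hV : V.toSubmodule ≤ Qdeg n 2 m) (h0 : V.toSubmodule ≠ ⊥) :
    ∃ a ≤ m, hwv hn m a ∈ V.toSubmodule := by
  obtain ⟨f, hfV, hf0, hu⟩ := exists_unInvariant V hV h0
  obtain ⟨c, rfl⟩ := exists_eq_sum_hwv hn (hV hfV) hu
  obtain ⟨a, ha, hca⟩ := Finset.exists_ne_zero_of_sum_ne_zero hf0
  have ha' : a ≤ m := by have := Finset.mem_range.1 ha; omega
  refine ⟨a, ha', ?_⟩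
  exact (Submodule.smul_mem_iff _ (smul_ne_zero_iff.1 hca).1).1
    (smul_hwv_mem hn _ (V.apply_mem_toSubmodule _) hfV ha')

theorem cyclic_hwv_le_Qdeg {m a : ℕ} (ha : a ≤ m) :
    (cyclic (glRep n 2) (hwv hn m a)).toSubmodule ≤ Qdeg n 2 m :=
  cyclic_le (S := ⟨Qdeg n 2 m, fun g _ h => glRep_mem_Qdeg g h⟩) (hwv_mem_Qdeg hn ha)

/-- The projection of the generator to `V` along a stable complement is invariant of the same
weight, hence a multiple of the generator. If it is zero, the generator lies in the complement and
`V` vanishes; otherwise `V` contains the generator. -/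
theorem eq_bot_or_eq_cyclic {m a : ℕ} (ha : a ≤ m) (V : Subrepresentation (glRep n 2))
    (hV : V.toSubmodule ≤ (cyclic (glRep n 2) (hwv hn m a)).toSubmodule) :
    V.toSubmodule = ⊥ ∨ V.toSubmodule = (cyclic (glRep n 2) (hwv hn m a)).toSubmodule := by
  have hQ := hV.trans (cyclic_hwv_le_Qdeg hn ha)
  have : FiniteDimensional ℂ V.toSubmodule := Submodule.finiteDimensional_of_le hQ
  obtain ⟨V', h1, h2⟩ := exists_complement V
  obtain ⟨p, hp, q, hq, hpq⟩ := Submodule.mem_sup.1 (h2 ▸ Submodule.mem_top : hwv hn m a ∈ _)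
  -- As the projection commutes with the group, `p` inherits every eigenvector equation of the
  -- generator: `g.p - c p` lies in both `V` and `V'`.
  have key : ∀ g (c : ℂ), glRep n 2 g (hwv hn m a) = c • hwv hn m a → glRep n 2 g p = c • p := by
    intro g c h
    rw [← hpq, map_add, smul_add] at h
    rw [← sub_eq_zero, ← Submodule.mem_bot ℂ, ← h1]
    refine ⟨V.toSubmodule.sub_mem (V.apply_mem_toSubmodule g hp) (V.toSubmodule.smul_mem c hp), ?_⟩
    have : glRep n 2 g p - c • p = c • q - glRep n 2 g q := by linear_combination h
    rw [this]
    exact V'.toSubmodule.sub_mem (V'.toSubmodule.smul_mem c hq) (V'.apply_mem_toSubmodule g hq)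
  obtain ⟨c, hc⟩ := eq_smul_hwv hn ha (hQ hp)
    (fun u hu => by
      simpa using key u 1 (by
        rw [one_smul]; exact alpha_pow_mul_gamma_pow_mem_unInvariants hn _ _ u hu))
    (key _ _ (testTorus_hwv hn ha))
  by_cases h0 : c = 0
  · left
    rw [h0, zero_smul] at hc
    rw [hc, zero_add] at hpq
    rw [hpq] at hq
    rw [eq_bot_iff, ← h1]
    exact le_inf le_rfl (hV.trans (cyclic_le hq))
  · right
    refine le_antisymm hV (cyclic_le ?_)
    exact (Submodule.smul_mem_iff _ h0).1 (hc ▸ hp)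

theorem isIrreducible_cyclic_hwv {m a : ℕ} (ha : a ≤ m) :
    (cyclic (glRep n 2) (hwv hn m a)).toRepresentation.IsIrreducible := by
  set W := cyclic (glRep n 2) (hwv hn m a)
  have hmem : hwv hn m a ∈ W.toSubmodule := mem_cyclic _ _
  refine { exists_pair_ne := ⟨⊥, ⊤, fun h => ?_⟩, eq_bot_or_eq_top := fun S => ?_ }
  · have : (⟨_, hmem⟩ : W.toSubmodule) ∈ (⊥ : Subrepresentation W.toRepresentation).toSubmodule := by
      rw [h]; exact Submodule.mem_top
    exact hwv_ne_zero hn m a (congrArg Subtype.val ((Submodule.mem_bot ℂ).1 this))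
  · let V : Subrepresentation (glRep n 2) :=
      ⟨S.toSubmodule.map W.toSubmodule.subtype, by
        rintro g _ ⟨x, hx, rfl⟩
        exact ⟨W.toRepresentation g x, S.apply_mem_toSubmodule g hx, rfl⟩⟩
    have hV : V.toSubmodule ≤ W.toSubmodule := by
      rintro _ ⟨x, _, rfl⟩
      exact x.2
    rcases eq_bot_or_eq_cyclic hn ha V hV with h | h
    · left
      apply Subrepresentation.toSubmodule_injective
      exact Submodule.map_injective_of_injective (Submodule.injective_subtype W.toSubmodule)
        (h.trans (Submodule.map_bot _).symm)
    · right
      apply Subrepresentation.toSubmodule_injective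
      refine Submodule.map_injective_of_injective (Submodule.injective_subtype W.toSubmodule) ?_
      change V.toSubmodule = Submodule.map _ ⊤
      rw [h, Submodule.map_subtype_top]

theorem isHighestWeightVector_hwv {m a : ℕ} (ha : a ≤ m) :
    IsHighestWeightVector (glRep n 2) (hwv hn m a) :=
  ⟨hwv_ne_zero hn m a, alpha_pow_mul_gamma_pow_mem_unInvariants hn _ _,
    fun t => ⟨_, glRep_diag_hwv hn ha t⟩⟩

theorem hasWeight_hwv {m a : ℕ} (ha : a ≤ m) :
    HasWeight (glRep n 2) (diagram m a ha) (hwv hn m a) := fun t => by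
  rw [glRep_diag_hwv hn ha, diagram,
    Finset.prod_eq_mul (⟨0, by omega⟩ : Fin n) ⟨1, by omega⟩ (by simp)]
  · simp [rowLen_twoRow]
  · intro i _ hi
    have h1 : (i : ℕ) ≠ 1 := fun h => hi.2 (Fin.ext h)
    have h0 : (i : ℕ) ≠ 0 := fun h => hi.1 (Fin.ext h)
    simp [rowLen_twoRow, h0, h1]
  · simp
  · simp

end TwoColumns

/-! ### Decomposition of the stable subspaces of `𝒬_m` -/

/-- A subrepresentation which is the internal direct sum of a family of subrepresentations is
isomorphic to the external direct sum. -/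
theorem nonempty_equiv_directSum {G V ι : Type*} [Group G] [AddCommGroup V] [Module ℂ V]
    {ρ : Representation ℂ G V} (S : Subrepresentation ρ) (W : ι → Subrepresentation ρ)
    (hind : iSupIndep fun i => (W i).toSubmodule) (hsup : ⨆ i, (W i).toSubmodule = S.toSubmodule)
    {X : ι → Type*} [∀ i, AddCommGroup (X i)] [∀ i, Module ℂ (X i)]
    (σ : ∀ i, Representation ℂ G (X i))
    (e : ∀ i, (W i).toRepresentation.Equiv (σ i)) :
    Nonempty (S.toRepresentation.Equiv (Representation.directSum σ)) := by
  classical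
  let E : (⨁ i, X i) ≃ₗ[ℂ] ⨁ i, (W i).toSubmodule :=
    DFinsupp.mapRange.linearEquiv fun i => (e i).toLinearEquiv.symm
  let F : (⨁ i, X i) →ₗ[ℂ] V :=
    DirectSum.coeLinearMap (fun i => (W i).toSubmodule) ∘ₗ E.toLinearMap
  have hF : ∀ x, F x ∈ S.toSubmodule := fun x => by
    rw [← hsup, ← DirectSum.range_coeLinearMap]
    exact ⟨E x, rfl⟩
  have hinj : Function.Injective F := by
    have h : Function.Injective (DirectSum.coeLinearMap fun i => (W i).toSubmodule) :=
      hind.dfinsupp_lsum_injective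
    exact h.comp E.injective
  have hFg : ∀ g x, F (Representation.directSum σ g x) = ρ g (F x) := by
    intro g x
    have : F ∘ₗ Representation.directSum σ g = ρ g ∘ₗ F := by
      refine DirectSum.linearMap_ext _ fun i => LinearMap.ext fun y => ?_
      have hFi : ∀ y : X i, F (DirectSum.lof ℂ ι X i y) = ((e i).symm y : V) := by
        intro y
        have : E (DirectSum.lof ℂ ι X i y) =
            DirectSum.lof ℂ ι (fun i => (W i).toSubmodule) i ((e i).symm y) :=
          DFinsupp.mapRange_single (hf := fun i => map_zero _)
        refine (congrArg (DirectSum.coeLinearMap fun i => (W i).toSubmodule) this).trans ?_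
        rw [DirectSum.coeLinearMap_lof]
      have h2 : Representation.directSum σ g (DirectSum.lof ℂ ι X i y) =
          DirectSum.lof ℂ ι X i (σ i g y) := DirectSum.lmap_lof _ _ _
      simp only [LinearMap.comp_apply, h2, hFi]
      have h3 := (e i).symm.toIntertwiningMap.2 g
      exact congrArg Subtype.val (DFunLike.congr_fun h3 y)
    exact DFunLike.congr_fun this x
  let L : (⨁ i, X i) ≃ₗ[ℂ] S.toSubmodule := LinearEquiv.ofBijective (F.codRestrict _ hF)
    ⟨fun x y h => hinj (congrArg Subtype.val h), fun ⟨y, hy⟩ => by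
      rw [← hsup, ← DirectSum.range_coeLinearMap] at hy
      obtain ⟨x, rfl⟩ := hy
      exact ⟨E.symm x, Subtype.ext (congrArg (DirectSum.coeLinearMap _) (E.apply_symm_apply x))⟩⟩
  refine ⟨Representation.Equiv.symm (Representation.Equiv.mk L fun g => LinearMap.ext fun x =>
    Subtype.ext (hFg g x))⟩

section TwoColumns

variable {n : ℕ} (hn : 2 ≤ n)

/-- The operator `D` commutes with `GL_n`, so it acts on a whole cyclic module by its eigenvalue
`(m-a)(m-a+1)` on the generator. This is strictly monotone in `m - a`, and distinct eigenspaces are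
independent. -/
theorem iSupIndep_cyclic_hwv (m : ℕ) (P : ℕ → Prop) :
    iSupIndep fun a : {a : ℕ // a ≤ m ∧ P a} =>
      (cyclic (glRep n 2) (hwv hn m a)).toSubmodule := by
  let D : Module.End ℂ (Poly n 2) :=
    (polarize n (0 : Fin 2) 1 : Poly n 2 →ₗ[ℂ] Poly n 2) ∘ₗ (polarize n (1 : Fin 2) 0 : Poly n 2 →ₗ[ℂ] Poly n 2)
  have hinj : Function.Injective fun a : {a : ℕ // a ≤ m ∧ P a} =>
      (((m - a) * (m - a + 1) : ℕ) : ℂ) := by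
    intro a b h
    have h' : (m - a) * (m - a + 1) = (m - b) * (m - b + 1) := Nat.cast_injective h
    have ha := a.2.1
    have hb := b.2.1
    have hab : m - a = m - (b : ℕ) := by
      rcases lt_trichotomy (m - (a : ℕ)) (m - b) with h | h | h
      · exact absurd h' (Nat.mul_lt_mul'' h (by omega)).ne
      · exact h
      · exact absurd h'.symm (Nat.mul_lt_mul'' h (by omega)).ne
    exact Subtype.ext (by omega)
  refine (D.eigenspaces_iSupIndep.comp hinj).mono fun a x hx => ?_
  rw [Function.comp_apply, Module.End.mem_eigenspace_iff]
  refine apply_eq_of_mem_cyclic D (fun g y => ?_) (polarize_polarize_hwv hn m a) hx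
  change polarize n 0 1 (polarize n 1 0 _) = glRep n 2 g (polarize n 0 1 (polarize n 1 0 _))
  rw [polarize_glRep, polarize_glRep]

/-- A stable complement of the sum meets `S` trivially: otherwise the intersection would contain
some `α^(m-a) γ^a`, which already lies in the sum. -/
theorem iSup_cyclic_hwv_eq {m : ℕ} {P : ℕ → Prop} (S : Subrepresentation (glRep n 2))
    (hS : S.toSubmodule ≤ Qdeg n 2 m) (hP : ∀ a ≤ m, hwv hn m a ∈ S.toSubmodule ↔ P a) :
    ⨆ a : {a : ℕ // a ≤ m ∧ P a}, (cyclic (glRep n 2) (hwv hn m a)).toSubmodule =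
      S.toSubmodule := by
  set T : Subrepresentation (glRep n 2) :=
    ⟨⨆ a : {a : ℕ // a ≤ m ∧ P a}, (cyclic (glRep n 2) (hwv hn m a)).toSubmodule,
      fun g x hx => by
        rw [← Submodule.mem_comap]
        refine (iSup_le fun a y hy => ?_ : _ ≤ Submodule.comap (glRep n 2 g) _) hx
        exact Submodule.mem_iSup_of_mem a
          ((cyclic (glRep n 2) (hwv hn m a)).apply_mem_toSubmodule g hy)⟩
  have hTS : T.toSubmodule ≤ S.toSubmodule :=
    iSup_le fun a => cyclic_le ((hP a a.2.1).2 a.2.2)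
  have : FiniteDimensional ℂ T.toSubmodule := Submodule.finiteDimensional_of_le (hTS.trans hS)
  obtain ⟨T', h1, h2⟩ := exists_complement T
  refine le_antisymm hTS ?_
  have hbot : (S ⊓ T').toSubmodule = ⊥ := by
    by_contra hne
    obtain ⟨a, ha, hmem⟩ := exists_hwv_mem hn (S ⊓ T') (inf_le_left.trans hS) hne
    have hmT : hwv hn m a ∈ T.toSubmodule :=
      Submodule.mem_iSup_of_mem ⟨a, ha, (hP a ha).1 hmem.1⟩ (mem_cyclic _ _)
    have : hwv hn m a ∈ T.toSubmodule ⊓ T'.toSubmodule := ⟨hmT, hmem.2⟩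
    rw [h1] at this
    exact hwv_ne_zero hn m a ((Submodule.mem_bot ℂ).1 this)
  intro x hx
  obtain ⟨p, hp, q, hq, rfl⟩ := Submodule.mem_sup.1 (h2 ▸ Submodule.mem_top : x ∈ _)
  have hqS : q ∈ (S ⊓ T').toSubmodule := ⟨by
    simpa using S.toSubmodule.sub_mem hx (hTS hp), hq⟩
  rw [hbot, Submodule.mem_bot] at hqS
  rw [hqS, add_zero]
  exact hp

/-- A stable subspace of `𝒬_m` is the direct sum of the irreducible submodules generated by the
vectors `α^(m-a) γ^a` which it contains. -/
theorem decomposition {m : ℕ} {P : ℕ → Prop} (S : Subrepresentation (glRep n 2))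
    (hS : S.toSubmodule ≤ Qdeg n 2 m) (hP : ∀ a ≤ m, hwv hn m a ∈ S.toSubmodule ↔ P a) :
    Nonempty (S.toRepresentation.Equiv
      (Representation.directSum fun a : {a : ℕ // a ≤ m ∧ P a} =>
        (irrep n (diagram m a a.2.1)).toRepresentation)) ∧
    ∃ W : {a : ℕ // a ≤ m ∧ P a} → Subrepresentation (glRep n 2),
      iSupIndep (fun a => (W a).toSubmodule) ∧
      ⨆ a, (W a).toSubmodule = S.toSubmodule ∧
      ∀ a : {a : ℕ // a ≤ m ∧ P a},
        (W a).toRepresentation.IsIrreducible ∧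
        Nonempty ((W a).toRepresentation.Equiv
          (irrep n (diagram m a a.2.1)).toRepresentation) ∧
        alpha n hn ^ (m - a) * gamma n hn ^ (a : ℕ) ∈ W a ∧
        IsHighestWeightVector (glRep n 2) (alpha n hn ^ (m - a) * gamma n hn ^ (a : ℕ)) ∧
        HasWeight (glRep n 2) (diagram m a a.2.1)
          (alpha n hn ^ (m - a) * gamma n hn ^ (a : ℕ)) ∧
        ∀ f ∈ W a, IsHighestWeightVector (glRep n 2) f →
          ∃ c : ℂ, f = c • (alpha n hn ^ (m - a) * gamma n hn ^ (a : ℕ)) := by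
  have hind := iSupIndep_cyclic_hwv hn m P
  have hsup := iSup_cyclic_hwv_eq hn S hS hP
  refine ⟨nonempty_equiv_directSum S _ hind hsup _ fun a => (nonempty_equiv_irrep hn a.2.1).some,
    fun a => cyclic (glRep n 2) (hwv hn m a), hind, hsup, fun a => ⟨isIrreducible_cyclic_hwv hn a.2.1,
    nonempty_equiv_irrep hn a.2.1, mem_cyclic _ _, isHighestWeightVector_hwv hn a.2.1,
    hasWeight_hwv hn a.2.1, fun f hf hw => ?_⟩⟩
  obtain ⟨hf0, hu, -⟩ := hw
  have hC : (cyclic (glRep n 2) f).toSubmodule =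
      (cyclic (glRep n 2) (hwv hn m a)).toSubmodule := by
    refine (eq_bot_or_eq_cyclic hn a.2.1 _ (cyclic_le hf)).resolve_left fun h => hf0 ?_
    rw [← Submodule.mem_bot ℂ, ← h]
    exact mem_cyclic _ _
  obtain ⟨c, rfl⟩ := exists_eq_sum_hwv hn (cyclic_hwv_le_Qdeg hn a.2.1 hf) hu
  refine ⟨c a, Finset.sum_eq_single (a : ℕ) (fun b hb hba => ?_) fun h => ?_⟩
  · have hb' : b ≤ m := by have := Finset.mem_range.1 hb; omega
    have hmem := smul_hwv_mem hn _
      ((cyclic (glRep n 2) (hwv hn m a)).apply_mem_toSubmodule _) hf hb'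
    by_contra hne
    have hmem' := (Submodule.smul_mem_iff _ (smul_ne_zero_iff.1 hne).1).1 hmem
    -- Independence is needed for all indices up to `m`, since `b` need not satisfy `P`.
    have hd := iSupIndep_cyclic_hwv hn m (fun _ => True)
    have := (hd.pairwiseDisjoint (i := ⟨b, hb', trivial⟩) (j := ⟨a, a.2.1, trivial⟩)
      (fun h => hba (congrArg Subtype.val h))).le_bot ⟨mem_cyclic _ _, hmem'⟩
    exact hwv_ne_zero hn m b ((Submodule.mem_bot ℂ).1 this)
  · have := a.2.1
    exact absurd (Finset.mem_range.2 (by omega)) h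

/-! ### Effect of the column swap on the highest weight vectors -/

theorem perm_fin_two : ∀ τ : Equiv.Perm (Fin 2), τ = 1 ∨ τ = Equiv.swap 0 1 := by
  decide

theorem hwv_mem_QsymDeg_iff {m a : ℕ} (ha : a ≤ m) :
    hwv hn m a ∈ (QsymDeg n 2 m).toSubmodule ↔ Even a := by
  have hs := symRep_swap_pow hn (m - a) a
  constructor
  · intro h
    have := h.2 (Equiv.swap 0 1)
    rw [hs] at this
    rcases Nat.even_or_odd a with he | ho
    · exact he
    · rw [ho.neg_one_pow, neg_one_smul, neg_eq_self] at this
      exact absurd this (hwv_ne_zero hn m a)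
  · intro h
    refine ⟨hwv_mem_Qdeg hn ha, fun τ => ?_⟩
    rcases perm_fin_two τ with rfl | rfl
    · simp
    · rw [hs, h.neg_one_pow, one_smul]

theorem hwv_mem_QsgnDeg_iff {m a : ℕ} (ha : a ≤ m) :
    hwv hn m a ∈ (QsgnDeg n 2 m).toSubmodule ↔ Odd a := by
  have hs := symRep_swap_pow hn (m - a) a
  constructor
  · intro h
    have := h.2 (Equiv.swap 0 1)
    rw [hs] at this
    rcases Nat.even_or_odd a with he | ho
    · rw [he.neg_one_pow, one_smul, Equiv.Perm.sign_swap (by decide)] at this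
      simp only [Units.val_neg, Units.val_one, Int.cast_neg, Int.cast_one, neg_one_smul,
        self_eq_neg] at this
      exact absurd this (hwv_ne_zero hn m a)
    · exact ho
  · intro h
    refine ⟨hwv_mem_Qdeg hn ha, fun τ => ?_⟩
    rcases perm_fin_two τ with rfl | rfl
    · simp
    · rw [hs, h.neg_one_pow, Equiv.Perm.sign_swap (by decide)]
      simp

end TwoColumns

/-! ### Symmetric and exterior squares of symmetric powers -/

/-- A multilinear map with values in a submodule on a spanning set has all its values there. -/
theorem multilinear_mem_of_span {ι V W : Type*} [Finite ι] [AddCommGroup V] [Module ℂ V]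
    [AddCommGroup W] [Module ℂ W] (f : MultilinearMap ℂ (fun _ : ι => V) W) {s : Set V}
    (hs : Submodule.span ℂ s = ⊤) (N : Submodule ℂ W)
    (h : ∀ w : ι → V, (∀ i, w i ∈ s) → f w ∈ N) (w : ι → V) : f w ∈ N := by
  classical
  have := Fintype.ofFinite ι
  -- The set `T` collects the slots whose entries are already arbitrary; the induction frees one
  -- more slot at a time.
  have key : ∀ T : Finset ι, ∀ w : ι → V, (∀ i, i ∉ T → w i ∈ s) → f w ∈ N := by
    intro T
    induction T using Finset.induction_on with
    | empty => exact fun w hw => h w fun i => hw i (Finset.notMem_empty i)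
    | insert a T ha ih =>
      intro w hw
      have : ∀ x ∈ Submodule.span ℂ s, f (Function.update w a x) ∈ N := by
        intro x hx
        induction hx using Submodule.span_induction with
        | mem x hx =>
          refine ih _ fun i hi => ?_
          by_cases hia : i = a
          · subst hia
            rwa [Function.update_self]
          · rw [Function.update_of_ne hia]
            exact hw i (by simp [hia, hi])
        | zero => rw [MultilinearMap.map_update_zero]; exact N.zero_mem
        | add x y _ _ hx hy => rw [MultilinearMap.map_update_add]; exact N.add_mem hx hy
        | smul c x _ hx => rw [MultilinearMap.map_update_smul]; exact N.smul_mem c hx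
      simpa using this (w a) (hs ▸ Submodule.mem_top)
  exact key Finset.univ w fun i hi => absurd (Finset.mem_univ i) hi

section SymLift

variable {V W : Type} [AddCommGroup V] [Module ℂ V] [AddCommGroup W] [Module ℂ W]

/-- The linear map on a symmetric power defined by a symmetric multilinear map. -/
def symLift {m : ℕ} (f : MultilinearMap ℂ (fun _ : Fin m => V) W)
    (hf : ∀ (e : Equiv.Perm (Fin m)) (v : Fin m → V), f (fun i => v (e i)) = f v) :
    SymmetricPower ℂ (Fin m) V →ₗ[ℂ] W where
  __ := AddCon.lift (addConGen (SymmetricPower.Rel ℂ (Fin m) V))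
    (PiTensorProduct.lift f).toAddMonoidHom
    (AddCon.addConGen_le.mpr fun x y h => by
      cases h with
      | perm e v =>
        exact (PiTensorProduct.lift.tprod v).trans
          ((hf e v).symm.trans (PiTensorProduct.lift.tprod fun i => v (e i)).symm))
  map_smul' c x := by
    induction x using AddCon.induction_on with
    | H x => exact (PiTensorProduct.lift f).map_smul c x

theorem symLift_tprod {m : ℕ} (f : MultilinearMap ℂ (fun _ : Fin m => V) W)
    (hf : ∀ (e : Equiv.Perm (Fin m)) (v : Fin m → V), f (fun i => v (e i)) = f v)
    (v : Fin m → V) : symLift f hf (SymmetricPower.tprod ℂ v) = f v :=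
  PiTensorProduct.lift.tprod v

end SymLift

/-! ### Symmetric powers of `ℂ^n` as forms in a single column -/

section Columns

variable (n : ℕ)

/-- The linear form with coefficients `v` in the variables of the column `j`. -/
def columnForm (j : Fin 2) : (Fin n → ℂ) →ₗ[ℂ] Poly n 2 :=
  Fintype.linearCombination ℂ fun i => X (i, j)

theorem columnForm_apply (j : Fin 2) (v : Fin n → ℂ) :
    columnForm n j v = ∑ i, v i • X (i, j) := rfl

theorem columnForm_single (j : Fin 2) (i : Fin n) :
    columnForm n j (Pi.single i 1) = X (i, j) := by
  rw [columnForm, Fintype.linearCombination_apply_single, one_smul]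

/-- The transpose in `f(gᵗ X)` is what makes these linear forms transform by the standard
representation and not by its dual. -/
theorem glRep_columnForm (j : Fin 2) (g : GL (Fin n) ℂ) (v : Fin n → ℂ) :
    glRep n 2 g (columnForm n j v) = columnForm n j (stdRep n g v) := by
  simp only [columnForm_apply, map_sum, map_smul, glRep_X, Finset.smul_sum]
  rw [Finset.sum_comm]
  refine Finset.sum_congr rfl fun s _ => ?_
  change _ = (((g : Matrix (Fin n) (Fin n) ℂ) *ᵥ v) s) • _
  rw [mulVec, dotProduct, Finset.sum_smul]
  refine Finset.sum_congr rfl fun i _ => ?_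
  rw [← smul_eq_C_mul, smul_smul, mul_comm]

theorem symRep_columnForm (τ : Equiv.Perm (Fin 2)) (j : Fin 2) (v : Fin n → ℂ) :
    symRep n 2 τ (columnForm n j v) = columnForm n (τ j) v := by
  simp only [columnForm_apply, map_sum, map_smul]
  refine Finset.sum_congr rfl fun i _ => ?_
  change _ • rename _ _ = _
  rw [rename_X]
  rfl

/-- The realization of the `m`-th symmetric power by polynomials in the column `j`. -/
def columnPow (m : ℕ) (j : Fin 2) : SymmetricPower ℂ (Fin m) (Fin n → ℂ) →ₗ[ℂ] Poly n 2 :=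
  symLift ((MultilinearMap.mkPiAlgebra ℂ (Fin m) (Poly n 2)).compLinearMap
    fun _ => columnForm n j) fun e v => by
      simp only [MultilinearMap.compLinearMap_apply, MultilinearMap.mkPiAlgebra_apply]
      exact Equiv.prod_comp e fun i => columnForm n j (v i)

theorem columnPow_tprod (m : ℕ) (j : Fin 2) (v : Fin m → Fin n → ℂ) :
    columnPow n m j (SymmetricPower.tprod ℂ v) = ∏ x, columnForm n j (v x) :=
  symLift_tprod _ _ v

theorem glRep_columnPow (m : ℕ) (j : Fin 2) (g : GL (Fin n) ℂ)
    (w : SymmetricPower ℂ (Fin m) (Fin n → ℂ)) :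
    glRep n 2 g (columnPow n m j w) = columnPow n m j (symPow m (stdRep n) g w) := by
  refine DFunLike.congr_fun (f := glRep n 2 g ∘ₗ columnPow n m j)
    (g := columnPow n m j ∘ₗ symPow m (stdRep n) g) (symPow_ext m fun v => ?_) w
  have h : symPow m (stdRep n) g (SymmetricPower.tprod ℂ v) =
      SymmetricPower.tprod ℂ fun i => stdRep n g (v i) := symPowMap_tprod m _ v
  rw [LinearMap.comp_apply, LinearMap.comp_apply, h, columnPow_tprod, columnPow_tprod,
    glRep_apply, map_prod]
  exact Finset.prod_congr rfl fun x _ => glRep_columnForm n j g _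

theorem symRep_columnPow (m : ℕ) (τ : Equiv.Perm (Fin 2)) (j : Fin 2)
    (w : SymmetricPower ℂ (Fin m) (Fin n → ℂ)) :
    symRep n 2 τ (columnPow n m j w) = columnPow n m (τ j) w := by
  refine DFunLike.congr_fun (f := symRep n 2 τ ∘ₗ columnPow n m j)
    (g := columnPow n m (τ j)) (symPow_ext m fun v => ?_) w
  rw [LinearMap.comp_apply, columnPow_tprod, columnPow_tprod]
  refine (map_prod (rename (Prod.map id τ) : Poly n 2 →ₐ[ℂ] Poly n 2) _ _).trans ?_
  exact Finset.prod_congr rfl fun x _ => symRep_columnForm n τ j _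

/-- The product of two elements of the symmetric power, in the two columns. -/
def columnMul (m : ℕ) :
    MultilinearMap ℂ (fun _ : Fin 2 => SymmetricPower ℂ (Fin m) (Fin n → ℂ)) (Poly n 2) :=
  (MultilinearMap.mkPiAlgebra ℂ (Fin 2) (Poly n 2)).compLinearMap fun j => columnPow n m j

theorem columnMul_apply (m : ℕ) (w : Fin 2 → SymmetricPower ℂ (Fin m) (Fin n → ℂ)) :
    columnMul n m w = ∏ j, columnPow n m j (w j) := rfl

theorem glRep_columnMul (m : ℕ) (g : GL (Fin n) ℂ)
    (w : Fin 2 → SymmetricPower ℂ (Fin m) (Fin n → ℂ)) :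
    glRep n 2 g (columnMul n m w) = columnMul n m fun j => symPow m (stdRep n) g (w j) := by
  simp only [columnMul_apply, Fin.prod_univ_two, glRep_mul, glRep_columnPow]

theorem symRep_swap_columnMul (m : ℕ) (w : Fin 2 → SymmetricPower ℂ (Fin m) (Fin n → ℂ)) :
    symRep n 2 (Equiv.swap 0 1) (columnMul n m w) =
      columnMul n m fun j => w (Equiv.swap 0 1 j) := by
  simp only [columnMul_apply, Fin.prod_univ_two, Equiv.swap_apply_left, Equiv.swap_apply_right]
  refine (map_mul (rename (Prod.map id (Equiv.swap 0 1)) : Poly n 2 →ₐ[ℂ] Poly n 2) _ _).trans ?_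
  rw [mul_comm]
  exact congrArg₂ _ (symRep_columnPow n m (Equiv.swap 0 1) 1 _)
    (symRep_columnPow n m (Equiv.swap 0 1) 0 _)

theorem symRep_swap_swap (f : Poly n 2) :
    symRep n 2 (Equiv.swap 0 1) (symRep n 2 (Equiv.swap 0 1) f) = f := by
  rw [← Module.End.mul_apply, ← map_mul, Equiv.swap_mul_self, map_one (symRep n 2),
    Module.End.one_apply]

variable {n}

/-- The product of standard basis vectors in the symmetric power. -/
def basisTprod {m : ℕ} (ψ : Fin m → Fin n) : SymmetricPower ℂ (Fin m) (Fin n → ℂ) :=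
  SymmetricPower.tprod ℂ fun x => Pi.single (ψ x) 1

theorem span_basisTprod (m : ℕ) :
    Submodule.span ℂ (Set.range (basisTprod : (Fin m → Fin n) → _)) = ⊤ := by
  rw [eq_top_iff, ← SymmetricPower.span_tprod_eq_top, Submodule.span_le]
  rintro _ ⟨v, rfl⟩
  refine multilinear_mem_of_span (SymmetricPower.tprod ℂ) (Pi.basisFun ℂ (Fin n)).span_eq _
    (fun w hw => ?_) v
  choose ψ hψ using hw
  refine Submodule.subset_span ⟨ψ, ?_⟩
  rw [basisTprod]
  congr 1
  ext1 x
  rw [← hψ, Pi.basisFun_apply]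

/-- The exponent of the monomial which corresponds to a pair of products of basis vectors. -/
def pairExponent {m : ℕ} (ψ : Fin 2 → Fin m → Fin n) : Fin n × Fin 2 →₀ ℕ :=
  ∑ j, ∑ x, Finsupp.single (ψ j x, j) 1

theorem pairExponent_apply {m : ℕ} (ψ : Fin 2 → Fin m → Fin n) (i : Fin n) (j : Fin 2) :
    pairExponent ψ (i, j) = Fintype.card {x // ψ j x = i} := by
  classical
  rw [pairExponent, Finsupp.finsetSum_apply, Finset.sum_eq_single j]
  · rw [Finsupp.finsetSum_apply, Fintype.card_subtype, Finset.card_filter]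
    exact Finset.sum_congr rfl fun x _ => by simp [Finsupp.single_apply]
  · intro b _ hb
    simp [Finsupp.finsetSum_apply, hb]
  · simp

theorem columnMul_basisTprod {m : ℕ} (ψ : Fin 2 → Fin m → Fin n) :
    columnMul n m (fun j => basisTprod (ψ j)) = monomial (pairExponent ψ) 1 := by
  rw [columnMul_apply, pairExponent, monomial_sum_one]
  refine Finset.prod_congr rfl fun j _ => ?_
  rw [basisTprod, columnPow_tprod, monomial_sum_one]
  exact Finset.prod_congr rfl fun x _ => columnForm_single n j _

/-- Fibres of equal size give a permutation `e` with `ψ ∘ e = φ`, and the symmetric power ignores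
the order of the factors. -/
theorem basisTprod_eq_of_card {m : ℕ} {φ ψ : Fin m → Fin n}
    (h : ∀ i, Fintype.card {x // φ x = i} = Fintype.card {x // ψ x = i}) :
    basisTprod φ = basisTprod ψ := by
  let e : Equiv.Perm (Fin m) := Equiv.ofFiberEquiv fun i => Fintype.equivOfCardEq (h i)
  have he : ∀ x, ψ (e x) = φ x := Equiv.ofFiberEquiv_map _
  have := SymmetricPower.tprod_equiv (R := ℂ) e
    (fun x => Pi.single (ψ x) 1 : Fin m → Fin n → ℂ)
  simp only [he] at this
  exact this

theorem basisTprod_eq_of_pairExponent {m : ℕ} {φ ψ : Fin 2 → Fin m → Fin n}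
    (h : pairExponent φ = pairExponent ψ) (j : Fin 2) : basisTprod (φ j) = basisTprod (ψ j) :=
  basisTprod_eq_of_card fun i => by rw [← pairExponent_apply, h, pairExponent_apply]

theorem sum_pairExponent {m : ℕ} (ψ : Fin 2 → Fin m → Fin n) (j : Fin 2) :
    ∑ i, pairExponent ψ (i, j) = m := by
  simp only [pairExponent_apply]
  rw [← Fintype.card_sigma, Fintype.card_congr (Equiv.sigmaFiberEquiv (ψ j)), Fintype.card_fin]

/-- In each column the `m` positions are divided into blocks of sizes `E (i, j)`, and the block
index is the required function. -/
theorem exists_pairExponent_eq {m : ℕ} {E : Fin n × Fin 2 →₀ ℕ} (hE : ∀ j, ∑ i, E (i, j) = m) :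
    ∃ ψ : Fin 2 → Fin m → Fin n, pairExponent ψ = E := by
  have h : ∀ j, ∃ φ : Fin m → Fin n, ∀ i, Fintype.card {x // φ x = i} = E (i, j) := by
    intro j
    have hc : Fintype.card (Fin m) = Fintype.card (Σ i, Fin (E (i, j))) := by
      rw [Fintype.card_sigma]
      simp [hE j]
    let e := Fintype.equivOfCardEq hc
    refine ⟨fun x => (e x).1, fun i => ?_⟩
    rw [Fintype.card_congr ((e.subtypeEquiv fun x => Iff.rfl : {x // (e x).1 = i} ≃
      {y : Σ i, Fin (E (i, j)) // y.1 = i}).trans (Equiv.sigmaSubtype i)), Fintype.card_fin]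
  choose ψ hψ using h
  refine ⟨ψ, Finsupp.ext fun ⟨i, j⟩ => ?_⟩
  rw [pairExponent_apply, hψ]

variable {Z : Type*} [AddCommGroup Z] [Module ℂ Z]

open Classical in
/-- The linear map which sends the monomial of a pair of products of basis vectors to half the
value of a multilinear map at this pair. -/
def monomialLift {m : ℕ}
    (π : MultilinearMap ℂ (fun _ : Fin 2 => SymmetricPower ℂ (Fin m) (Fin n → ℂ)) Z) :
    Poly n 2 →ₗ[ℂ] Z :=
  (basisMonomials (Fin n × Fin 2) ℂ).constr ℂ fun E =>
    if h : ∃ ψ : Fin 2 → Fin m → Fin n, pairExponent ψ = E then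
      (2⁻¹ : ℂ) • π fun j => basisTprod (h.choose j) else 0

/-- The pair chosen in the definition may differ from `ψ`, but equal exponents give equal products
in the symmetric power. -/
theorem monomialLift_pairExponent {m : ℕ}
    (π : MultilinearMap ℂ (fun _ : Fin 2 => SymmetricPower ℂ (Fin m) (Fin n → ℂ)) Z)
    (ψ : Fin 2 → Fin m → Fin n) :
    monomialLift π (monomial (pairExponent ψ) 1) =
      (2⁻¹ : ℂ) • π fun j => basisTprod (ψ j) := by
  have h : ∃ φ : Fin 2 → Fin m → Fin n, pairExponent φ = pairExponent ψ := ⟨ψ, rfl⟩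
  have := (basisMonomials (Fin n × Fin 2) ℂ).constr_basis ℂ (fun E =>
    if h : ∃ ψ : Fin 2 → Fin m → Fin n, pairExponent ψ = E then
      (2⁻¹ : ℂ) • π fun j => basisTprod (h.choose j) else 0) (pairExponent ψ)
  rw [coe_basisMonomials, dif_pos h] at this
  refine this.trans ?_
  congr 2
  exact funext fun j => basisTprod_eq_of_pairExponent h.choose_spec j

/-- The symmetric (`ε = 1`) or alternating (`ε = -1`) part of `𝒬_m` is isomorphic to the
symmetric or alternating square of the `m`-th symmetric power. -/
theorem nonempty_equiv_square {m : ℕ} (ρ : Representation ℂ (GL (Fin n) ℂ) Z)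
    (π : MultilinearMap ℂ (fun _ : Fin 2 => SymmetricPower ℂ (Fin m) (Fin n → ℂ)) Z) (ε : ℂ)
    (hε : ε * ε = 1) (hspan : Submodule.span ℂ (Set.range π) = ⊤)
    (hswap : ∀ w, π (fun j => w (Equiv.swap 0 1 j)) = ε • π w)
    (hρ : ∀ g w, ρ g (π w) = π fun j => symPow m (stdRep n) g (w j))
    (F : Z →ₗ[ℂ] Poly n 2)
    (hF : ∀ w, F (π w) = columnMul n m w + ε • columnMul n m fun j => w (Equiv.swap 0 1 j))
    (S : Subrepresentation (glRep n 2))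
    (hS : ∀ f, f ∈ S.toSubmodule ↔ f ∈ Qdeg n 2 m ∧ symRep n 2 (Equiv.swap 0 1) f = ε • f) :
    Nonempty (S.toRepresentation.Equiv ρ) := by
  have hbasis : Submodule.span ℂ (Set.range fun ψ : Fin 2 → Fin m → Fin n =>
      π fun j => basisTprod (ψ j)) = ⊤ := by
    rw [eq_top_iff, ← hspan, Submodule.span_le]
    rintro _ ⟨w, rfl⟩
    refine multilinear_mem_of_span π (span_basisTprod m) _ (fun w hw => ?_) w
    choose ψ hψ using hw
    exact Submodule.subset_span ⟨ψ, congrArg π (funext hψ)⟩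
  have hswapmon : ∀ ψ : Fin 2 → Fin m → Fin n,
      symRep n 2 (Equiv.swap 0 1) (monomial (pairExponent ψ) 1) =
        monomial (pairExponent fun j => ψ (Equiv.swap 0 1 j)) 1 := by
    intro ψ
    rw [← columnMul_basisTprod, symRep_swap_columnMul,
      ← columnMul_basisTprod fun j => ψ (Equiv.swap 0 1 j)]
  have hFψ : ∀ ψ : Fin 2 → Fin m → Fin n, F (π fun j => basisTprod (ψ j)) =
      monomial (pairExponent ψ) 1 +
        ε • symRep n 2 (Equiv.swap 0 1) (monomial (pairExponent ψ) 1) := by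
    intro ψ
    rw [hF, ← symRep_swap_columnMul n m fun j => basisTprod (ψ j), columnMul_basisTprod]
  have hFS : ∀ z, F z ∈ S.toSubmodule := by
    have : ⊤ ≤ S.toSubmodule.comap F := by
      rw [← hbasis, Submodule.span_le]
      rintro _ ⟨ψ, rfl⟩
      rw [SetLike.mem_coe, Submodule.mem_comap, hS, hFψ]
      refine ⟨Submodule.add_mem _ (monomial_mem_Qdeg (sum_pairExponent ψ) 1)
        (Submodule.smul_mem _ _ ?_), ?_⟩
      · rw [hswapmon]
        exact monomial_mem_Qdeg (sum_pairExponent _) 1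
      · rw [map_add, map_smul, symRep_swap_swap, smul_add, smul_smul, hε, one_smul, add_comm]
    exact fun z => this Submodule.mem_top
  -- On a generator, the two monomials of `F` contribute `½ π` and `½ ε² π`, so the factor one half
  -- in `monomialLift` is the right one.
  have hRF : ∀ z, monomialLift π (F z) = z := by
    have : monomialLift π ∘ₗ F = LinearMap.id := by
      refine LinearMap.ext_on_range hbasis fun ψ => ?_
      rw [LinearMap.comp_apply, hFψ, map_add, map_smul, hswapmon, monomialLift_pairExponent,
        monomialLift_pairExponent, hswap fun j => basisTprod (ψ j), smul_comm ε, smul_smul ε,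
        hε, one_smul, ← add_smul, LinearMap.id_apply]
      norm_num
    exact DFunLike.congr_fun this
  -- In the other order the composite is the projector `½ (1 + ε τ)` onto the `ε`-eigenspace of the
  -- swap `τ`, hence the identity on `S`.
  have hFR : ∀ f ∈ Qdeg n 2 m, F (monomialLift π f) =
      (2⁻¹ : ℂ) • (f + ε • symRep n 2 (Equiv.swap 0 1) f) := by
    intro f hf
    rw [f.as_sum]
    simp only [map_sum, Finset.smul_sum, ← Finset.sum_add_distrib]
    refine Finset.sum_congr rfl fun E hE => ?_
    obtain ⟨ψ, rfl⟩ := exists_pairExponent_eq (mem_Qdeg_iff.1 hf E hE)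
    rw [← mul_one (coeff _ f), ← smul_eq_mul, ← smul_monomial]
    simp only [map_smul]
    rw [monomialLift_pairExponent, map_smul, hFψ, smul_comm ε, ← smul_add, smul_comm]
  have hFR' : ∀ f ∈ S.toSubmodule, F (monomialLift π f) = f := by
    intro f hf
    obtain ⟨h1, h2⟩ := (hS f).1 hf
    rw [hFR f h1, h2, smul_smul, hε, one_smul, ← two_smul ℂ f, smul_smul]
    norm_num
  have hFg : ∀ g z, F (ρ g z) = glRep n 2 g (F z) := by
    intro g z
    refine DFunLike.congr_fun (f := F ∘ₗ ρ g) (g := glRep n 2 g ∘ₗ F) ?_ z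
    refine LinearMap.ext_on_range hspan fun w => ?_
    rw [LinearMap.comp_apply, LinearMap.comp_apply, hρ, hF, hF, map_add, map_smul,
      glRep_columnMul, glRep_columnMul]
  let L : Z ≃ₗ[ℂ] S.toSubmodule := LinearEquiv.ofLinearMap (F.codRestrict _ hFS)
    (monomialLift π ∘ₗ S.toSubmodule.subtype)
    (LinearMap.ext fun f => Subtype.ext (hFR' f f.2)) (LinearMap.ext hRF)
  exact ⟨Representation.Equiv.symm (Representation.Equiv.mk L fun g => LinearMap.ext fun z =>
    Subtype.ext (hFg g z))⟩

theorem nonempty_equiv_symPow (m : ℕ) :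
    Nonempty ((QsymDeg n 2 m).toRepresentation.Equiv (symPow 2 (symPow m (stdRep n)))) := by
  refine nonempty_equiv_square _ (SymmetricPower.tprod ℂ) 1 (one_mul 1)
    (SymmetricPower.span_tprod_eq_top ℂ _ _) (fun w => ?_) (fun g w => ?_)
    (symLift (columnMul n m + (columnMul n m).domDomCongr (Equiv.swap 0 1)) fun e w => ?_)
    (fun w => ?_) _ fun f => ?_
  · rw [one_smul, SymmetricPower.tprod_equiv]
  · exact symPowMap_tprod 2 _ w
  · rcases perm_fin_two e with rfl | rfl
    · rfl
    · simp [add_comm]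
  · rw [symLift_tprod, one_smul]
    rfl
  · rw [one_smul]
    refine and_congr_right fun _ => ⟨fun h => h _, fun h τ => ?_⟩
    rcases perm_fin_two τ with rfl | rfl
    · simp
    · exact h

theorem nonempty_equiv_extPow (m : ℕ) :
    Nonempty ((QsgnDeg n 2 m).toRepresentation.Equiv (extPow 2 (symPow m (stdRep n)))) := by
  have hsign : Equiv.Perm.sign (Equiv.swap (0 : Fin 2) 1) = -1 :=
    Equiv.Perm.sign_swap (by decide)
  refine nonempty_equiv_square _ (exteriorPower.ιMulti ℂ 2).toMultilinearMap (-1)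
    (by norm_num) (exteriorPower.ιMulti_span ℂ 2 _) (fun w => ?_) (fun g w => ?_)
    (exteriorPower.alternatingMapLinearEquiv (columnMul n m).alternatization)
    (fun w => ?_) _ fun f => ?_
  · have := (exteriorPower.ιMulti ℂ 2).map_perm w (Equiv.swap 0 1)
    rw [hsign] at this
    refine this.trans ?_
    simp
  · exact exteriorPower.map_apply_ιMulti _ w
  · refine (exteriorPower.alternatingMapLinearEquiv_apply_ιMulti _ w).trans ?_
    have huniv : (Finset.univ : Finset (Equiv.Perm (Fin 2))) = {1, Equiv.swap 0 1} := by decide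
    rw [MultilinearMap.alternatization_apply, huniv, Finset.sum_pair (by decide), hsign]
    simp
  · refine and_congr_right fun _ => ⟨fun h => ?_, fun h τ => ?_⟩
    · rw [h, hsign]
      simp
    · rcases perm_fin_two τ with rfl | rfl
      · simp
      · rw [h, hsign]
        simp

end Columns

/-! ### The algebra of `U_n`-invariants -/

theorem adjoin_pair_eq_span {A : Type*} [CommRing A] [Algebra ℂ A] (x y : A) :
    Subalgebra.toSubmodule (Algebra.adjoin ℂ {x, y}) =
      Submodule.span ℂ (Set.range fun p : ℕ × ℕ => x ^ p.1 * y ^ p.2) := by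
  rw [Algebra.adjoin_eq_span]
  congr 1
  ext z
  rw [SetLike.mem_coe, Submonoid.mem_closure_pair]
  simp

/-- The multihomogeneous components of a polynomial fixed by `U_n` are fixed by `U_n`. -/
theorem mem_iSup_Qdeg_inf_unInvariants {n k : ℕ} (hk : k ≠ 0) {f : Poly n k} (hf : f ∈ Q n k)
    (hu : f ∈ unInvariants (glRep n k)) : f ∈ ⨆ m, Qdeg n k m ⊓ unInvariants (glRep n k) := by
  obtain ⟨x, hx, rfl⟩ := (Submodule.mem_iSup_iff_exists_finsupp _ _).1 hf
  have hinj : Function.Injective fun m : ℕ => ((2 ^ k : ℕ) : ℂ) ^ m := fun a b h =>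
    Nat.pow_right_injective (Nat.one_lt_two_pow hk) (by
      simp only at h
      exact_mod_cast h)
  -- The scalar matrix `2` in `GL_k` acts on `𝒬_m` by `2^(km)`, which separates the degrees because
  -- `k ≠ 0`.
  have hT : ∀ m, polyAction n k (1, diagGL fun _ => Units.mk0 (2 : ℂ) two_ne_zero) (x m) =
      ((2 ^ k : ℕ) : ℂ) ^ m • x m := fun m => by
    refine (hx m _).trans ?_
    simp [← pow_mul, mul_comm]
  refine Submodule.sum_mem _ fun m hm => Submodule.mem_iSup_of_mem m ⟨hx m, ?_⟩
  refine mem_of_sum_eigenvectors _ (unInvariants (glRep n k)) (fun y hy u hu' => ?_) _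
    x.support hinj.injOn x (fun m _ => hT m) hu m hm
  rw [← polyAction_eq_comp, hy u hu']

section TwoColumns

variable {n : ℕ} (hn : 2 ≤ n)

theorem span_hwv_eq (m : ℕ) :
    Submodule.span ℂ (Set.range fun a : Fin (m + 1) =>
      alpha n hn ^ (m - a) * gamma n hn ^ (a : ℕ)) = Qdeg n 2 m ⊓ unInvariants (glRep n 2) := by
  refine le_antisymm ?_ fun f hf => ?_
  · rw [Submodule.span_le]
    rintro _ ⟨a, rfl⟩
    exact ⟨hwv_mem_Qdeg hn (Nat.lt_succ_iff.1 a.isLt),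
      alpha_pow_mul_gamma_pow_mem_unInvariants hn _ _⟩
  · obtain ⟨c, rfl⟩ := exists_eq_sum_hwv hn hf.1 hf.2
    exact Submodule.sum_mem _ fun a ha => Submodule.smul_mem _ _
      (Submodule.subset_span ⟨⟨a, Finset.mem_range.1 ha⟩, rfl⟩)

theorem span_monomials_eq :
    Submodule.span ℂ (Set.range fun p : ℕ × ℕ => alpha n hn ^ p.1 * gamma n hn ^ p.2) =
      Q n 2 ⊓ unInvariants (glRep n 2) := by
  refine le_antisymm ?_ fun f hf => ?_
  · rw [Submodule.span_le]
    rintro _ ⟨p, rfl⟩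
    exact ⟨Submodule.mem_iSup_of_mem _ (alpha_pow_mul_gamma_pow_mem_Qdeg hn p.1 p.2),
      alpha_pow_mul_gamma_pow_mem_unInvariants hn _ _⟩
  · refine (iSup_le fun m => ?_ : ⨆ m, Qdeg n 2 m ⊓ unInvariants (glRep n 2) ≤ _)
      (mem_iSup_Qdeg_inf_unInvariants two_ne_zero hf.1 hf.2)
    rw [← span_hwv_eq hn m]
    refine Submodule.span_mono ?_
    rintro _ ⟨a, rfl⟩
    exact ⟨(m - a, a), rfl⟩

theorem range_hwv_eq : (Set.range fun p : (m : ℕ) × Fin (m + 1) =>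
    alpha n hn ^ (p.1 - p.2) * gamma n hn ^ (p.2 : ℕ)) =
      Set.range fun p : ℕ × ℕ => alpha n hn ^ p.1 * gamma n hn ^ p.2 := by
  ext f
  constructor
  · rintro ⟨⟨m, a⟩, rfl⟩
    exact ⟨(m - a, a), rfl⟩
  · rintro ⟨⟨i, j⟩, rfl⟩
    exact ⟨⟨i + j, ⟨j, by omega⟩⟩, by simp⟩

theorem linearIndependent_hwv : LinearIndependent ℂ (fun p : (m : ℕ) × Fin (m + 1) =>
    alpha n hn ^ (p.1 - p.2) * gamma n hn ^ (p.2 : ℕ)) := by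
  -- On `α^(m-a) γ^a` this torus element has eigenvalue `2^(2m-a) 3^a`, from which unique
  -- factorization recovers `a` and then `m`.
  let t : Fin n → ℂˣ := fun i =>
    if (i : ℕ) = 0 then Units.mk0 (2 : ℂ) two_ne_zero else Units.mk0 (3 : ℂ) three_ne_zero
  refine Module.End.eigenvectors_linearIndependent' (glRep n 2 (diagGL t))
    (fun p : (m : ℕ) × Fin (m + 1) => ((2 ^ (2 * p.1 - (p.2 : ℕ)) * 3 ^ (p.2 : ℕ) : ℕ) : ℂ)) ?_ _ fun p => ⟨?_, ?_⟩
  · rintro ⟨m, a⟩ ⟨m', a'⟩ h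
    have h' : 2 ^ (2 * m - a) * 3 ^ (a : ℕ) = 2 ^ (2 * m' - a') * 3 ^ (a' : ℕ) :=
      Nat.cast_injective h
    have h2 : ∀ x y : ℕ, (2 ^ x * 3 ^ y).factorization 2 = x ∧
        (2 ^ x * 3 ^ y).factorization 3 = y := fun x y => by
      rw [Nat.factorization_mul (by positivity) (by positivity), Nat.Prime.factorization_pow
        Nat.prime_two, Nat.Prime.factorization_pow Nat.prime_three]
      simp
    have ha : (a : ℕ) = a' := by rw [← (h2 (2 * m - a) a).2, h', (h2 _ _).2]
    have hm : 2 * m - a = 2 * m' - (a' : ℕ) := by rw [← (h2 (2 * m - a) a).1, h', (h2 _ _).1]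
    have := a.isLt
    have := a'.isLt
    obtain rfl : m = m' := by omega
    obtain rfl : a = a' := Fin.ext ha
    rfl
  · rw [Module.End.mem_eigenspace_iff]
    refine (glRep_diag_hwv hn (Nat.lt_succ_iff.1 p.2.isLt) t).trans ?_
    simp [t]
  · exact hwv_ne_zero hn _ _

theorem Qsym_inf_unInvariants : Qsym n 2 ⊓ unInvariants (glRep n 2) =
    Subalgebra.toSubmodule (Algebra.adjoin ℂ {alpha n hn, gamma n hn ^ 2}) := by
  rw [adjoin_pair_eq_span]
  refine le_antisymm ?_ ?_
  · rintro f ⟨⟨hQ, hs⟩, hu⟩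
    -- Symmetrizing doubles the monomials with an even power of `γ` and kills the others; on a
    -- symmetric `f` it is multiplication by `2`.
    have key : ∀ f ∈ Q n 2 ⊓ unInvariants (glRep n 2),
        f + symRep n 2 (Equiv.swap 0 1) f ∈ Submodule.span ℂ
          (Set.range fun p : ℕ × ℕ => alpha n hn ^ p.1 * (gamma n hn ^ 2) ^ p.2) := by
      intro f hf
      rw [← span_monomials_eq hn] at hf
      induction hf using Submodule.span_induction with
      | mem x hx =>
        obtain ⟨⟨i, j⟩, rfl⟩ := hx
        simp only [symRep_swap_pow]
        rcases Nat.even_or_odd' j with ⟨l, rfl | rfl⟩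
        · rw [(even_two_mul l).neg_one_pow, one_smul, pow_mul]
          exact Submodule.add_mem _ (Submodule.subset_span ⟨(i, l), rfl⟩)
            (Submodule.subset_span ⟨(i, l), rfl⟩)
        · rw [(odd_two_mul_add_one l).neg_one_pow, neg_one_smul, add_neg_cancel]
          exact Submodule.zero_mem _
      | zero => simp
      | add x y _ _ hx hy =>
        rw [map_add, add_add_add_comm]
        exact Submodule.add_mem _ hx hy
      | smul c x _ hx =>
        rw [map_smul, ← smul_add]
        exact Submodule.smul_mem _ c hx
    have := key f ⟨hQ, hu⟩
    rw [hs, ← two_smul ℂ f] at this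
    exact (Submodule.smul_mem_iff _ two_ne_zero).1 this
  · rw [Submodule.span_le]
    rintro _ ⟨⟨i, j⟩, rfl⟩
    simp only [← pow_mul]
    refine ⟨⟨Submodule.mem_iSup_of_mem _ (alpha_pow_mul_gamma_pow_mem_Qdeg hn i (2 * j)),
      fun τ => ?_⟩, alpha_pow_mul_gamma_pow_mem_unInvariants hn _ _⟩
    rcases perm_fin_two τ with rfl | rfl
    · simp
    · rw [symRep_swap_pow, (even_two_mul j).neg_one_pow, one_smul]

theorem Qsgn_inf_unInvariants : Qsgn n 2 ⊓ unInvariants (glRep n 2) =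
    (Subalgebra.toSubmodule (Algebra.adjoin ℂ {alpha n hn, gamma n hn ^ 2})).map
      (LinearMap.mulLeft ℂ (gamma n hn)) := by
  have hsign : Equiv.Perm.sign (Equiv.swap (0 : Fin 2) 1) = -1 :=
    Equiv.Perm.sign_swap (by decide)
  rw [adjoin_pair_eq_span]
  refine le_antisymm ?_ ?_
  · rintro f ⟨⟨hQ, hs⟩, hu⟩
    -- Antisymmetrizing keeps exactly the odd powers of `γ`, from which one factor `γ` splits off.
    have key : ∀ f ∈ Q n 2 ⊓ unInvariants (glRep n 2),
        f - symRep n 2 (Equiv.swap 0 1) f ∈ (Submodule.span ℂ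
          (Set.range fun p : ℕ × ℕ => alpha n hn ^ p.1 * (gamma n hn ^ 2) ^ p.2)).map
            (LinearMap.mulLeft ℂ (gamma n hn)) := by
      intro f hf
      rw [← span_monomials_eq hn] at hf
      induction hf using Submodule.span_induction with
      | mem x hx =>
        obtain ⟨⟨i, j⟩, rfl⟩ := hx
        simp only [symRep_swap_pow]
        rcases Nat.even_or_odd' j with ⟨l, rfl | rfl⟩
        · rw [(even_two_mul l).neg_one_pow, one_smul, sub_self]
          exact Submodule.zero_mem _
        · rw [(odd_two_mul_add_one l).neg_one_pow, neg_one_smul, sub_neg_eq_add]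
          have : alpha n hn ^ i * gamma n hn ^ (2 * l + 1) ∈ (Submodule.span ℂ
              (Set.range fun p : ℕ × ℕ => alpha n hn ^ p.1 * (gamma n hn ^ 2) ^ p.2)).map
                (LinearMap.mulLeft ℂ (gamma n hn)) :=
            ⟨_, Submodule.subset_span ⟨(i, l), rfl⟩, by
              rw [LinearMap.mulLeft_apply]
              ring⟩
          exact Submodule.add_mem _ this this
      | zero => simp
      | add x y _ _ hx hy =>
        rw [map_add, add_sub_add_comm]
        exact Submodule.add_mem _ hx hy
      | smul c x _ hx =>
        rw [map_smul, ← smul_sub]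
        exact Submodule.smul_mem _ c hx
    have h := key f ⟨hQ, hu⟩
    rw [hs, hsign, Units.val_neg, Units.val_one, Int.cast_neg, Int.cast_one, neg_one_smul,
      sub_neg_eq_add, ← two_smul ℂ f] at h
    exact (Submodule.smul_mem_iff _ two_ne_zero).1 h
  · rw [Submodule.map_span, Submodule.span_le]
    rintro _ ⟨_, ⟨⟨i, j⟩, rfl⟩, rfl⟩
    have : gamma n hn * (alpha n hn ^ i * (gamma n hn ^ 2) ^ j) =
        alpha n hn ^ i * gamma n hn ^ (2 * j + 1) := by ring
    simp only [LinearMap.mulLeft_apply, this]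
    refine ⟨⟨Submodule.mem_iSup_of_mem _ (alpha_pow_mul_gamma_pow_mem_Qdeg hn i (2 * j + 1)),
      fun τ => ?_⟩, alpha_pow_mul_gamma_pow_mem_unInvariants hn _ _⟩
    rcases perm_fin_two τ with rfl | rfl
    · simp
    · rw [symRep_swap_pow, (odd_two_mul_add_one j).neg_one_pow, hsign]
      simp

end TwoColumns

end Plethysm

end

theorem mainTheorem6 (n : ℕ) (hn : 2 ≤ n) :
    -- (i) generators and basis of the algebra of `U_n`-invariants
    (Subalgebra.toSubmodule (Algebra.adjoin ℂ {alpha n hn, gamma n hn}) =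
        Q n 2 ⊓ unInvariants (glRep n 2) ∧
      LinearIndependent ℂ (fun p : (m : ℕ) × Fin (m + 1) =>
        alpha n hn ^ (p.1 - p.2) * gamma n hn ^ (p.2 : ℕ)) ∧
      Submodule.span ℂ (Set.range fun p : (m : ℕ) × Fin (m + 1) =>
        alpha n hn ^ (p.1 - p.2) * gamma n hn ^ (p.2 : ℕ)) =
        Q n 2 ⊓ unInvariants (glRep n 2) ∧
      ∀ m : ℕ, Submodule.span ℂ (Set.range fun a : Fin (m + 1) =>
        alpha n hn ^ (m - a) * gamma n hn ^ (a : ℕ)) =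
        Qdeg n 2 m ⊓ unInvariants (glRep n 2)) ∧
    -- (ii) the symmetric square
    (∀ m : ℕ, 1 ≤ m →
      Nonempty ((QsymDeg n 2 m).toRepresentation.Equiv (symPow 2 (symPow m (stdRep n)))) ∧
      Nonempty ((symPow 2 (symPow m (stdRep n))).Equiv
        (Representation.directSum fun a : {a : ℕ // a ≤ m ∧ Even a} =>
          (irrep n (diagram m a a.2.1)).toRepresentation)) ∧
      ∃ W : {a : ℕ // a ≤ m ∧ Even a} → Subrepresentation (glRep n 2),
        iSupIndep (fun a => (W a).toSubmodule) ∧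
        ⨆ a, (W a).toSubmodule = (QsymDeg n 2 m).toSubmodule ∧
        ∀ a : {a : ℕ // a ≤ m ∧ Even a},
          (W a).toRepresentation.IsIrreducible ∧
          Nonempty ((W a).toRepresentation.Equiv
            (irrep n (diagram m a a.2.1)).toRepresentation) ∧
          alpha n hn ^ (m - a) * gamma n hn ^ (a : ℕ) ∈ W a ∧
          IsHighestWeightVector (glRep n 2) (alpha n hn ^ (m - a) * gamma n hn ^ (a : ℕ)) ∧
          HasWeight (glRep n 2) (diagram m a a.2.1)
            (alpha n hn ^ (m - a) * gamma n hn ^ (a : ℕ)) ∧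
          ∀ f ∈ W a, IsHighestWeightVector (glRep n 2) f →
            ∃ c : ℂ, f = c • (alpha n hn ^ (m - a) * gamma n hn ^ (a : ℕ))) ∧
    -- (iii) the exterior square
    (∀ m : ℕ, 1 ≤ m →
      Nonempty ((QsgnDeg n 2 m).toRepresentation.Equiv (extPow 2 (symPow m (stdRep n)))) ∧
      Nonempty ((extPow 2 (symPow m (stdRep n))).Equiv
        (Representation.directSum fun a : {a : ℕ // a ≤ m ∧ Odd a} =>
          (irrep n (diagram m a a.2.1)).toRepresentation)) ∧
      ∃ W : {a : ℕ // a ≤ m ∧ Odd a} → Subrepresentation (glRep n 2),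
        iSupIndep (fun a => (W a).toSubmodule) ∧
        ⨆ a, (W a).toSubmodule = (QsgnDeg n 2 m).toSubmodule ∧
        ∀ a : {a : ℕ // a ≤ m ∧ Odd a},
          (W a).toRepresentation.IsIrreducible ∧
          Nonempty ((W a).toRepresentation.Equiv
            (irrep n (diagram m a a.2.1)).toRepresentation) ∧
          alpha n hn ^ (m - a) * gamma n hn ^ (a : ℕ) ∈ W a ∧
          IsHighestWeightVector (glRep n 2) (alpha n hn ^ (m - a) * gamma n hn ^ (a : ℕ)) ∧
          HasWeight (glRep n 2) (diagram m a a.2.1)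
            (alpha n hn ^ (m - a) * gamma n hn ^ (a : ℕ)) ∧
          ∀ f ∈ W a, IsHighestWeightVector (glRep n 2) f →
            ∃ c : ℂ, f = c • (alpha n hn ^ (m - a) * gamma n hn ^ (a : ℕ))) ∧
    -- (iv) the `U_n`-invariants in the symmetric and in the alternating part
    (Qsym n 2 ⊓ unInvariants (glRep n 2) =
        Subalgebra.toSubmodule (Algebra.adjoin ℂ {alpha n hn, gamma n hn ^ 2}) ∧
      Qsgn n 2 ⊓ unInvariants (glRep n 2) =
        (Qsym n 2 ⊓ unInvariants (glRep n 2)).map (LinearMap.mulLeft ℂ (gamma n hn)) ∧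
      Qsgn n 2 ⊓ unInvariants (glRep n 2) =
        (Subalgebra.toSubmodule (Algebra.adjoin ℂ {alpha n hn, gamma n hn ^ 2})).map
          (LinearMap.mulLeft ℂ (gamma n hn))) := by
  refine ⟨⟨?_, linearIndependent_hwv hn, ?_, span_hwv_eq hn⟩, fun m _ => ?_, fun m _ => ?_,
    Qsym_inf_unInvariants hn, ?_, Qsgn_inf_unInvariants hn⟩
  · rw [adjoin_pair_eq_span, span_monomials_eq]
  · rw [range_hwv_eq, span_monomials_eq]
  · obtain ⟨⟨e⟩, h⟩ := decomposition hn (QsymDeg n 2 m) inf_le_left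
      (P := Even) fun a ha => hwv_mem_QsymDeg_iff hn ha
    obtain ⟨e'⟩ := nonempty_equiv_symPow (n := n) m
    exact ⟨⟨e'⟩, ⟨e'.symm.trans e⟩, h⟩
  · obtain ⟨⟨e⟩, h⟩ := decomposition hn (QsgnDeg n 2 m) inf_le_left
      (P := Odd) fun a ha => hwv_mem_QsgnDeg_iff hn ha
    obtain ⟨e'⟩ := nonempty_equiv_extPow (n := n) m
    exact ⟨⟨e'⟩, ⟨e'.symm.trans e⟩, h⟩
  · rw [Qsym_inf_unInvariants hn, Qsgn_inf_unInvariants hn]
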